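/- Fix complex numbers $H=(h_{11},h_{12},h_{21},h_{22})$. In the Gaussian interference channel with common information, transmitters $1,2$ send $X_1(t),X_2(t)\in\mathbb{C}$ at time $t$ and receivers $1,2$ observe $$Y_1(t)=h_{11}X_1(t)+h_{12}X_2(t)+Z_1(t),\qquad Y_2(t)=h_{21}X_1(t)+h_{22}X_2(t)+Z_2(t),$$ where the noise pairs $(Z_1(t),Z_2(t))$ are i.i.d. over $t$, each of $Z_1(t),Z_2(t)$ is circularly symmetric complex Gaussian $\mathcal{CN}(0,1)$ (with an arbitrary dependence between $Z_1(t)$ and $Z_2(t)$, for instance independent), and the noise is independent of the messages. A coding scheme of block length $n$ and rates $(R_0,R_1,R_2)$ consists of independent messages $M_0,M_1,M_2$, with $M_i$ uniform on the set of integers $\{1,2,\dots,\lfloor 2^{nR_i}\rfloor\}$; of encoders that produce, for $i=1,2$ and $t=1,\dots,n$, $X_i(t)=f_i(M_0,M_i,t)$ subject to $\frac1n\sum_{t=1}^n\mathbb{E}|X_i(t)|^2\le 1$; and of (measurable) decoders $(\hat M_{0i},\hat M_i)=g_i(Y_i(1),\dots,Y_i(n))$, $i=1,2$ (encoders and decoders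 may depend on $H$). Its error probability is $$P_e^{(n)}=\Pr\{M_1\ne\hat M_1\text{ or }M_2\ne\hat M_2\text{ or }M_0\ne\hat M_{01}\text{ or }M_0\ne\hat M_{02}\}.$$ The triple $(R_0,R_1,R_2)$ is achievable if there is a sequence of coding schemes with these rates, one for each block length $n$, with $P_e^{(n)}\to0$ as $n\to\infty$. The capacity region $\mathbf{C}(H)$ is the closure in $\mathbb{R}^3$ of the set of achievable triples. Let $\mathsf{C}(P)=\log_2(1+P)$ and $$\overline A_1=\mathsf{C}\Big(\tfrac{|h_{11}|^2}{1+|h_{21}|^2}\Big),\quad \overline A_2=\mathsf{C}\Big(\tfrac{|h_{22}|^2}{1+|h_{12}|^2}\Big),\quad \overline D_1=\mathsf{C}(|h_{11}|^2),\quad \overline D_2=\mathsf{C}(|h_{22}|^2),$$ $$\overline E_1=\mathsf{C}\Big(|h_{12}|^2+\tfrac{|h_{11}|^2}{1+|h_{21}|^2}\Big),\quad \overline E_2=\mathsf{C}\Big(|h_{21}|^2+\tfrac{|h_{22}|^2}{1+|h_{12}|^2}\Big),$$ $$\overline G_1=\mathsf{C}(|h_{11}|^2+|h_{12}|^2),\quad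 \overline G_2=\mathsf{C}(|h_{22}|^2+|h_{21}|^2),\quad \overline G_1'=\mathsf{C}\big((|h_{11}|+|h_{12}|)^2\big),\quad \overline G_2'=\mathsf{C}\big((|h_{22}|+|h_{21}|)^2\big).$$ Let $\mathbf{C}_{\rm outer}(H)$ be the set of all $(R_0,R_1,R_2)$ with $R_0,R_1,R_2\ge0$ and $$R_0+R_1\le\overline G_1',\quad R_0+R_2\le\overline G_2',\quad R_1\le\overline D_1,\quad R_2\le\overline D_2,\quad R_1+R_2\le\overline E_1+\overline E_2,$$ $$R_1+R_2\le\overline A_1+\overline G_2,\quad R_1+R_2\le\overline A_2+\overline G_1,\quad R_0+R_1+R_2\le\overline A_1+\overline G_2',\quad R_0+R_1+R_2\le\overline A_2+\overline G_1',$$ $$2R_1+R_2\le\overline A_1+\overline G_1+\overline E_2,\quad R_1+2R_2\le\overline A_2+\overline G_2+\overline E_1,$$ $$R_0+2R_1+R_2\le\overline A_1+\overline G_1'+\overline E_2,\quad R_0+R_1+2R_2\le\overline A_2+\overline G_2'+\overline E_1.$$ Then, for every $H\in\mathbb{C}^4$, $\mathbf{C}(H)\subseteq\mathbf{C}_{\rm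 outer}(H)$. -/

import Mathlib

open MeasureTheory ProbabilityTheory Filter Topology

noncomputable section

namespace ICCI

/-- The four complex channel coefficients `H = (h₁₁, h₁₂, h₂₁, h₂₂)`; `hᵢⱼ` is the coefficient
from transmitter `j` to receiver `i`. -/
structure Channel where
  h11 : ℂ
  h12 : ℂ
  h21 : ℂ
  h22 : ℂ

/-- The circularly symmetric complex Gaussian law `𝒞𝒩(0,1)`: the real and imaginary parts are
independent real Gaussians of mean `0` and variance `1/2`. -/
def stdCN : Measure ℂ :=
  ((gaussianReal 0 (1 / 2)).prod (gaussianReal 0 (1 / 2))).map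
    (fun p : ℝ × ℝ => (p.1 : ℂ) + (p.2 : ℂ) * Complex.I)

/-- The size of the message set `{1, 2, …, 2^{nR}}` (the integers between `1` and `2^{nR}`). -/
def msgCount (n : ℕ) (R : ℝ) : ℕ := ⌊(2 : ℝ) ^ ((n : ℝ) * R)⌋₊

/-- The law of the message triple `(M₀, M₁, M₂)`: independent, each uniform on its set. -/
def msgLaw (K0 K1 K2 : ℕ) : Measure (Fin K0 × Fin K1 × Fin K2) :=
  (uniformOn (Set.univ : Set (Fin K0))).prod
    ((uniformOn (Set.univ : Set (Fin K1))).prod (uniformOn (Set.univ : Set (Fin K2))))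

/-- A coding scheme of block length `n` with `K0`, `K1`, `K2` messages: encoders that see the
common message and their own message and satisfy the average power constraint
`(1/n) ∑ₜ 𝔼|Xᵢ(t)|² ≤ 1`, and decoders that see the received block and estimate the common
message and the individual message of the paired transmitter. -/
structure CodingScheme (n K0 K1 K2 : ℕ) where
  /-- encoder of transmitter 1 -/
  enc1 : Fin K0 → Fin K1 → Fin n → ℂ
  /-- encoder of transmitter 2 -/
  enc2 : Fin K0 → Fin K2 → Fin n → ℂ
  power1 : (1 / (n : ℝ)) * ∑ t, ∫ m, ‖enc1 m.1 m.2.1 t‖ ^ 2 ∂(msgLaw K0 K1 K2) ≤ 1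
  power2 : (1 / (n : ℝ)) * ∑ t, ∫ m, ‖enc2 m.1 m.2.2 t‖ ^ 2 ∂(msgLaw K0 K1 K2) ≤ 1
  /-- decoder of receiver 1 -/
  dec1 : (Fin n → ℂ) → Fin K0 × Fin K1
  /-- decoder of receiver 2 -/
  dec2 : (Fin n → ℂ) → Fin K0 × Fin K2
  measurable_dec1 : Measurable dec1
  measurable_dec2 : Measurable dec2

namespace CodingScheme

variable {n K0 K1 K2 : ℕ}

/-- The block received by receiver 1 for messages `m` and noise realization `z`, where
`z t = (Z₁(t), Z₂(t))`. -/
def Y1 (c : CodingScheme n K0 K1 K2) (H : Channel)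
    (m : Fin K0 × Fin K1 × Fin K2) (z : Fin n → ℂ × ℂ) : Fin n → ℂ :=
  fun t => H.h11 * c.enc1 m.1 m.2.1 t + H.h12 * c.enc2 m.1 m.2.2 t + (z t).1

/-- The block received by receiver 2. -/
def Y2 (c : CodingScheme n K0 K1 K2) (H : Channel)
    (m : Fin K0 × Fin K1 × Fin K2) (z : Fin n → ℂ × ℂ) : Fin n → ℂ :=
  fun t => H.h21 * c.enc1 m.1 m.2.1 t + H.h22 * c.enc2 m.1 m.2.2 t + (z t).2

/-- The event that one of the receivers gets one of its two desired messages wrong. -/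
def errorEvent (c : CodingScheme n K0 K1 K2) (H : Channel) :
    Set ((Fin K0 × Fin K1 × Fin K2) × (Fin n → ℂ × ℂ)) :=
  {ω | ω.1.2.1 ≠ (c.dec1 (c.Y1 H ω.1 ω.2)).2 ∨ ω.1.2.2 ≠ (c.dec2 (c.Y2 H ω.1 ω.2)).2 ∨
    ω.1.1 ≠ (c.dec1 (c.Y1 H ω.1 ω.2)).1 ∨ ω.1.1 ≠ (c.dec2 (c.Y2 H ω.1 ω.2)).1}

/-- The probability of error, when the noise pairs `(Z₁(t), Z₂(t))` are i.i.d. over `t` with law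
`noise` and independent of the messages. -/
def errorProb (c : CodingScheme n K0 K1 K2) (H : Channel) (noise : Measure (ℂ × ℂ)) : ℝ :=
  ((msgLaw K0 K1 K2).prod (Measure.pi fun _ : Fin n => noise)).real (c.errorEvent H)

end CodingScheme

/-- Achievability of `(R₀, R₁, R₂)`: coding schemes of every block length with these rates whose
error probability tends to `0`. Negative rates are never achievable, because the message set is
then empty for `n ≥ 1` and there is no decoder. -/
def Achievable (H : Channel) (noise : Measure (ℂ × ℂ)) (R : ℝ × ℝ × ℝ) : Prop :=
  ∃ c : ∀ n : ℕ, CodingScheme n (msgCount n R.1) (msgCount n R.2.1) (msgCount n R.2.2),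
    Tendsto (fun n => (c n).errorProb H noise) atTop (𝓝 0)

/-- The capacity region: the closure of the set of achievable rate triples. -/
def capacityRegion (H : Channel) (noise : Measure (ℂ × ℂ)) : Set (ℝ × ℝ × ℝ) :=
  closure {R | Achievable H noise R}

/-- `C(P) = log₂ (1 + P)`. -/
def capC (P : ℝ) : ℝ := Real.logb 2 (1 + P)

namespace Channel

def A1 (H : Channel) : ℝ := capC (‖H.h11‖ ^ 2 / (1 + ‖H.h21‖ ^ 2))

def A2 (H : Channel) : ℝ := capC (‖H.h22‖ ^ 2 / (1 + ‖H.h12‖ ^ 2))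

def D1 (H : Channel) : ℝ := capC (‖H.h11‖ ^ 2)

def D2 (H : Channel) : ℝ := capC (‖H.h22‖ ^ 2)

def E1 (H : Channel) : ℝ := capC (‖H.h12‖ ^ 2 + ‖H.h11‖ ^ 2 / (1 + ‖H.h21‖ ^ 2))

def E2 (H : Channel) : ℝ := capC (‖H.h21‖ ^ 2 + ‖H.h22‖ ^ 2 / (1 + ‖H.h12‖ ^ 2))

def G1 (H : Channel) : ℝ := capC (‖H.h11‖ ^ 2 + ‖H.h12‖ ^ 2)

def G2 (H : Channel) : ℝ := capC (‖H.h22‖ ^ 2 + ‖H.h21‖ ^ 2)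

def G1' (H : Channel) : ℝ := capC ((‖H.h11‖ + ‖H.h12‖) ^ 2)

def G2' (H : Channel) : ℝ := capC ((‖H.h22‖ + ‖H.h21‖) ^ 2)

end Channel

/-- The polytope `C_outer(H)`. -/
def outerRegion (H : Channel) : Set (ℝ × ℝ × ℝ) :=
  {R | ∃ R0 R1 R2 : ℝ, R = (R0, R1, R2) ∧
    0 ≤ R0 ∧ 0 ≤ R1 ∧ 0 ≤ R2 ∧
    R0 + R1 ≤ H.G1' ∧
    R0 + R2 ≤ H.G2' ∧
    R1 ≤ H.D1 ∧
    R2 ≤ H.D2 ∧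
    R1 + R2 ≤ H.E1 + H.E2 ∧
    R1 + R2 ≤ H.A1 + H.G2 ∧
    R1 + R2 ≤ H.A2 + H.G1 ∧
    R0 + R1 + R2 ≤ H.A1 + H.G2' ∧
    R0 + R1 + R2 ≤ H.A2 + H.G1' ∧
    2 * R1 + R2 ≤ H.A1 + H.G1 + H.E2 ∧
    R1 + 2 * R2 ≤ H.A2 + H.G2 + H.E1 ∧
    R0 + 2 * R1 + R2 ≤ H.A1 + H.G1' + H.E2 ∧
    R0 + R1 + 2 * R2 ≤ H.A2 + H.G2' + H.E1}

end ICCI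

end

/-!
The converse is the genie argument of Etkin, Tse and Wang, carried out conditionally on the common
message, and with Gibbs' inequality in place of differential entropy.

At one receiver, with direct coefficient `h` and interfering coefficient `k`, Fano's inequality
amounts to Gibbs' inequality for a test law of all the variables: the receiver's message is drawn
from a posterior built from the decoder, the genie signal has its true law, and the received block
is Gaussian with a variance chosen for full power (`genie_fano`). The test law is Gaussian from the
start, so no entropy maximization or concavity argument is needed. The power constraint enters only
through the second moment of the linear minimum mean square error estimate (`mmse_eq`).

Let `a` be the information that transmitter 1 leaks to receiver 2, that is the mutual information
given `M₀` between `M₁` and `h₂₁ X₁ + noise`, and let `b` be the information leaked in the other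
direction (`privateInfo`). Per channel use, and up to a vanishing slack, receiver 1 gives
`R₁ ≤ D₁`, `R₁ ≤ a + A₁`, `R₁ ≤ G₁ - b`, `R₀ + R₁ ≤ G₁' - b` and `R₁ ≤ a - b + E₁`
(`receiver_rate_bounds`). Receiver 2 gives the same with `a` and `b` exchanged. The bounds `D₁` and
`G₁` are the bounds `A₁` and `E₁` with a genie that reveals only noise. Eliminating `a` and `b`, both
nonnegative, yields every inequality of the outer region (`Achievable.mem_outerRegion`). The region
is closed, so it contains the closure of the achievable set.

Only the marginal laws of the two noises matter: each bound concerns one receiver, and its genie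
noise is a fresh Gaussian block independent of the noise of that receiver.
-/

namespace ICCI

open scoped BigOperators ENNReal

/-! ### Complex Gaussian noise -/

/-- The squared Euclidean norm of a block. -/
noncomputable def sqNorm {n : ℕ} (z : Fin n → ℂ) : ℝ := ∑ t, ‖z t‖ ^ 2

/-- The law of a block of `n` independent `𝒞𝒩(0,1)` noise samples. -/
noncomputable def gaussBlock (n : ℕ) : Measure (Fin n → ℂ) := Measure.pi fun _ => stdCN

theorem measurable_toComplex : Measurable (fun p : ℝ × ℝ => (p.1 : ℂ) + (p.2 : ℂ) * Complex.I) := by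
  fun_prop

instance : IsProbabilityMeasure stdCN :=
  Measure.isProbabilityMeasure_map measurable_toComplex.aemeasurable

instance (n : ℕ) : IsProbabilityMeasure (gaussBlock n) := by
  unfold gaussBlock; infer_instance

@[fun_prop]
theorem continuous_sqNorm {n : ℕ} : Continuous (sqNorm (n := n)) := by
  unfold sqNorm; fun_prop

@[fun_prop]
theorem measurable_sqNorm {n : ℕ} : Measurable (sqNorm (n := n)) := continuous_sqNorm.measurable

theorem sqNorm_nonneg {n : ℕ} (z : Fin n → ℂ) : 0 ≤ sqNorm z :=
  Finset.sum_nonneg fun _ _ => sq_nonneg _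

theorem toComplex_eq (p : ℝ × ℝ) :
    (p.1 : ℂ) + (p.2 : ℂ) * Complex.I = Complex.measurableEquivRealProd.symm p := by
  apply Complex.ext <;> simp

theorem stdCN_eq_withDensity :
    stdCN = volume.withDensity fun z : ℂ => ENNReal.ofReal (Real.pi⁻¹ * Real.exp (-‖z‖ ^ 2)) := by
  have hv : (1 / 2 : NNReal) ≠ 0 := by norm_num
  unfold stdCN
  rw [gaussianReal_of_var_ne_zero _ hv,
    prod_withDensity (measurable_gaussianPDF _ _) (measurable_gaussianPDF _ _)]
  ext s hs
  rw [Measure.map_apply measurable_toComplex hs, withDensity_apply _ (measurable_toComplex hs),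
    withDensity_apply _ hs]
  have e : (fun p : ℝ × ℝ => (p.1 : ℂ) + (p.2 : ℂ) * Complex.I)
      = Complex.measurableEquivRealProd.symm := funext toComplex_eq
  rw [e, ← Complex.volume_preserving_equiv_real_prod.symm.setLIntegral_comp_preimage_emb
    (MeasurableEquiv.measurableEmbedding _)]
  refine lintegral_congr fun p => ?_
  rw [gaussianPDF, gaussianPDF, ← ENNReal.ofReal_mul (gaussianPDFReal_nonneg _ _ _)]
  congr 1
  rw [← toComplex_eq, ← Complex.normSq_eq_norm_sq, Complex.normSq_add_mul_I, gaussianPDFReal,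
    gaussianPDFReal]
  have : (2 * Real.pi * ((1 / 2 : NNReal) : ℝ)) = Real.pi := by push_cast; ring
  rw [this]
  have h2 : (√Real.pi)⁻¹ * (√Real.pi)⁻¹ = Real.pi⁻¹ := by
    rw [← mul_inv, Real.mul_self_sqrt Real.pi_pos.le]
  rw [mul_mul_mul_comm, h2, ← Real.exp_add]
  congr 2
  push_cast
  ring

theorem lintegral_pi_prod {n : ℕ} (f : Fin n → ℂ → ℝ≥0∞) (hf : ∀ i, Measurable (f i)) :
    ∫⁻ x : Fin n → ℂ, ∏ i, f i (x i) = ∏ i, ∫⁻ z, f i z := by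
  induction n with
  | zero => simp [Measure.volume_pi_eq_dirac (fun _ : Fin 0 => (0 : ℂ))]
  | succ n ih =>
    rw [← (volume_preserving_piFinSuccAbove (fun _ : Fin (n + 1) => ℂ) 0).symm.lintegral_comp_emb
      (MeasurableEquiv.measurableEmbedding _)]
    simp only [MeasurableEquiv.piFinSuccAbove_symm_apply, Fin.insertNthEquiv, Fin.prod_univ_succ,
      Equiv.coe_fn_mk, Fin.insertNth_zero', Fin.cons_zero, Fin.cons_succ]
    rw [Measure.volume_eq_prod, lintegral_prod_mul
      (g := fun a : Fin n → ℂ => ∏ i, f i.succ (a i)) (hf 0).aemeasurable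
      (Finset.measurable_prod _ fun i _ => (hf _).comp (measurable_pi_apply i)).aemeasurable,
      ih _ fun i => hf _]

theorem gaussBlock_eq_withDensity (n : ℕ) :
    gaussBlock n = volume.withDensity fun z : Fin n → ℂ =>
      ENNReal.ofReal (Real.pi⁻¹ ^ n * Real.exp (-sqNorm z)) := by
  have hd : ∀ z : Fin n → ℂ, ENNReal.ofReal (Real.pi⁻¹ ^ n * Real.exp (-sqNorm z))
      = ∏ t, ENNReal.ofReal (Real.pi⁻¹ * Real.exp (-‖z t‖ ^ 2)) := by
    intro z
    rw [← ENNReal.ofReal_prod_of_nonneg fun t _ => by positivity, Finset.prod_mul_distrib,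
      ← Real.exp_sum, Finset.sum_neg_distrib]
    simp [sqNorm]
  unfold gaussBlock
  refine Measure.pi_eq fun s hs => ?_
  rw [withDensity_apply _ (MeasurableSet.univ_pi hs), ← lintegral_indicator (MeasurableSet.univ_pi hs)]
  have : ∀ z : Fin n → ℂ, (Set.univ.pi s).indicator (fun z : Fin n → ℂ =>
      ENNReal.ofReal (Real.pi⁻¹ ^ n * Real.exp (-sqNorm z))) z
      = ∏ t, (s t).indicator (fun z => ENNReal.ofReal (Real.pi⁻¹ * Real.exp (-‖z‖ ^ 2))) (z t) := by
    intro z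
    by_cases hz : z ∈ Set.univ.pi s
    · rw [Set.indicator_of_mem hz, hd]
      exact Finset.prod_congr rfl fun t _ => by rw [Set.indicator_of_mem (hz t trivial)]
    · rw [Set.indicator_of_notMem hz]
      simp only [Set.mem_univ_pi, not_forall] at hz
      obtain ⟨t, ht⟩ := hz
      exact (Finset.prod_eq_zero (Finset.mem_univ t) (Set.indicator_of_notMem ht _)).symm
  simp_rw [this]
  rw [lintegral_pi_prod _ fun t => Measurable.indicator (by fun_prop) (hs t)]
  refine Finset.prod_congr rfl fun t _ => ?_
  rw [lintegral_indicator (hs t), stdCN_eq_withDensity, withDensity_apply _ (hs t)]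

theorem lintegral_exp_neg_sqNorm_div {n : ℕ} (m : Fin n → ℂ) {v : ℝ} (hv : 0 < v) :
    ∫⁻ y : Fin n → ℂ, ENNReal.ofReal (Real.exp (-(sqNorm (y - m) / v)))
      = ENNReal.ofReal ((Real.pi * v) ^ n) := by
  rw [lintegral_sub_right_eq_self (fun y : Fin n → ℂ =>
    ENNReal.ofReal (Real.exp (-(sqNorm y / v)))) m]
  have hd : ∀ z : Fin n → ℂ, ENNReal.ofReal (Real.exp (-(sqNorm z / v)))
      = ∏ t, ENNReal.ofReal (Real.exp (-v⁻¹ * ‖z t‖ ^ 2)) := by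
    intro z
    rw [← ENNReal.ofReal_prod_of_nonneg fun t _ => by positivity,
      ← Real.exp_sum, ← Finset.mul_sum, sqNorm]
    congr 2
    ring
  simp_rw [hd]
  rw [lintegral_pi_prod (fun _ z => ENNReal.ofReal (Real.exp (-v⁻¹ * ‖z‖ ^ 2)))
    fun t => by fun_prop]
  have hv' : 0 < v⁻¹ := inv_pos.2 hv
  have hI := GaussianFourier.integral_rexp_neg_mul_sq_norm (V := ℂ) hv'
  have hint : Integrable fun z : ℂ => Real.exp (-v⁻¹ * ‖z‖ ^ 2) := by
    -- The Bochner integral of a non-integrable function is `0`, and this one is positive.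
    by_contra h
    rw [integral_undef h] at hI
    have : 0 < (Real.pi / v⁻¹) ^ ((Module.finrank ℝ ℂ : ℝ) / 2) := by positivity
    exact this.ne hI
  rw [Finset.prod_const, ← ofReal_integral_eq_lintegral_ofReal hint (ae_of_all _ fun _ => by positivity),
    hI, ← ENNReal.ofReal_pow (by positivity)]
  simp [Complex.finrank_real_complex]

/-! ### Second moments of the noise -/

theorem memLp_stdCN : MemLp (fun z : ℂ => z) 2 stdCN := by
  unfold stdCN
  rw [memLp_map_measure_iff (by fun_prop) measurable_toComplex.aemeasurable]
  have h : MemLp id 2 (gaussianReal 0 (1 / 2)) := memLp_id_gaussianReal' 2 (by simp)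
  have h1 := (h.comp_fst (gaussianReal 0 (1 / 2))).ofReal (K := ℂ)
  have h2 := ((h.comp_snd (gaussianReal 0 (1 / 2))).ofReal (K := ℂ)).mul_const Complex.I
  exact h1.add h2

theorem integrable_stdCN : Integrable (fun z : ℂ => z) stdCN := memLp_stdCN.integrable (by norm_num)

theorem integrable_normSq_stdCN : Integrable (fun z : ℂ => ‖z‖ ^ 2) stdCN :=
  memLp_stdCN.integrable_norm_pow two_ne_zero

theorem integral_stdCN : ∫ z, z ∂stdCN = 0 := by
  have h : Integrable (fun p : ℝ => (p : ℂ)) (gaussianReal 0 (1 / 2)) :=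
    ((memLp_id_gaussianReal' 1 (by simp)).integrable le_rfl).ofReal
  have h0 : ∫ p : ℝ, (p : ℂ) ∂(gaussianReal 0 (1 / 2)) = 0 := by
    rw [integral_complex_ofReal, integral_id_gaussianReal]; simp
  unfold stdCN
  rw [integral_map measurable_toComplex.aemeasurable (by fun_prop),
    integral_add (h.comp_fst _) ((h.comp_snd _).mul_const _), integral_mul_const,
    integral_fun_fst (fun p : ℝ => (p : ℂ)), integral_fun_snd (fun p : ℝ => (p : ℂ)), h0]
  simp

theorem integral_normSq_stdCN : ∫ z, ‖z‖ ^ 2 ∂stdCN = 1 := by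
  have hL : MemLp id 2 (gaussianReal 0 (1 / 2)) := memLp_id_gaussianReal' 2 (by simp)
  have h : Integrable (fun p : ℝ => p ^ 2) (gaussianReal 0 (1 / 2)) := hL.integrable_sq
  have h0 : ∫ p : ℝ, p ^ 2 ∂(gaussianReal 0 (1 / 2)) = 1 / 2 := by
    have := variance_eq_sub hL
    rw [variance_id_gaussianReal] at this
    simp only [Pi.pow_apply, id, integral_id_gaussianReal] at this
    simpa using this.symm
  unfold stdCN
  rw [integral_map measurable_toComplex.aemeasurable (by fun_prop)]
  simp_rw [← Complex.normSq_eq_norm_sq, Complex.normSq_add_mul_I]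
  rw [integral_add (h.comp_fst _) (h.comp_snd _),
    integral_fun_fst (fun p : ℝ => p ^ 2), integral_fun_snd (fun p : ℝ => p ^ 2), h0]
  norm_num

theorem norm_add_mul_sq (x c z : ℂ) :
    ‖x + c * z‖ ^ 2 = ‖x‖ ^ 2 + ‖c‖ ^ 2 * ‖z‖ ^ 2 + 2 * (starRingEnd ℂ x * c * z).re := by
  simp only [← Complex.normSq_eq_norm_sq, Complex.normSq_apply, Complex.add_re, Complex.add_im,
    Complex.mul_re, Complex.mul_im, Complex.conj_re, Complex.conj_im]
  ring

theorem integrable_norm_add_mul_sq (x c : ℂ) :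
    Integrable (fun z : ℂ => ‖x + c * z‖ ^ 2) stdCN := by
  simp_rw [norm_add_mul_sq]
  exact ((integrable_const _).add (integrable_normSq_stdCN.const_mul _)).add
    ((integrable_stdCN.const_mul _).re.const_mul 2)

theorem integral_norm_add_mul_sq (x c : ℂ) :
    ∫ z, ‖x + c * z‖ ^ 2 ∂stdCN = ‖x‖ ^ 2 + ‖c‖ ^ 2 := by
  have hre : ∫ z, (starRingEnd ℂ x * c * z).re ∂stdCN = 0 := by
    have := integral_re (𝕜 := ℂ) (integrable_stdCN.const_mul (starRingEnd ℂ x * c))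
    rw [integral_const_mul, integral_stdCN] at this
    simpa using this
  simp_rw [norm_add_mul_sq]
  have h1 : Integrable (fun z : ℂ => ‖x‖ ^ 2 + ‖c‖ ^ 2 * ‖z‖ ^ 2) stdCN :=
    (integrable_const _).add (integrable_normSq_stdCN.const_mul _)
  have h2 : Integrable (fun z : ℂ => 2 * (starRingEnd ℂ x * c * z).re) stdCN :=
    (integrable_stdCN.const_mul _).re.const_mul 2
  rw [integral_add h1 h2, integral_add (integrable_const _)
    (integrable_normSq_stdCN.const_mul _), integral_const_mul, integral_const_mul,
    integral_normSq_stdCN, hre]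
  simp

theorem integrable_sqNorm_add_smul {n : ℕ} (x : Fin n → ℂ) (c : ℂ) :
    Integrable (fun z => sqNorm (x + c • z)) (gaussBlock n) := by
  unfold sqNorm gaussBlock
  refine integrable_finsetSum _ fun t _ => ?_
  exact integrable_comp_eval (μ := fun _ : Fin n => stdCN) (i := t)
    (integrable_norm_add_mul_sq (x t) c)

theorem integral_sqNorm_add_smul {n : ℕ} (x : Fin n → ℂ) (c : ℂ) :
    ∫ z, sqNorm (x + c • z) ∂(gaussBlock n) = sqNorm x + n * ‖c‖ ^ 2 := by
  unfold sqNorm gaussBlock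
  have h : ∀ t : Fin n, Integrable (fun z : Fin n → ℂ => ‖x t + c * z t‖ ^ 2)
      (Measure.pi fun _ => stdCN) := fun t =>
    integrable_comp_eval (μ := fun _ : Fin n => stdCN) (i := t)
      (integrable_norm_add_mul_sq (x t) c)
  simp only [Pi.add_apply, Pi.smul_apply, smul_eq_mul]
  rw [integral_finsetSum _ fun t _ => h t]
  have h2 : ∀ t : Fin n, ∫ z : Fin n → ℂ, ‖x t + c * z t‖ ^ 2 ∂(Measure.pi fun _ => stdCN)
      = ‖x t‖ ^ 2 + ‖c‖ ^ 2 := fun t => by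
    rw [integral_comp_eval (μ := fun _ : Fin n => stdCN) (i := t)
      (f := fun z : ℂ => ‖x t + c * z‖ ^ 2) (by fun_prop), integral_norm_add_mul_sq]
  simp_rw [h2]
  simp [Finset.sum_add_distrib]

theorem integrable_sqNorm_add {n : ℕ} (x : Fin n → ℂ) :
    Integrable (fun z => sqNorm (z + x)) (gaussBlock n) := by
  simpa [add_comm] using integrable_sqNorm_add_smul x 1

theorem integrable_sqNorm (n : ℕ) : Integrable sqNorm (gaussBlock n) := by
  simpa using integrable_sqNorm_add (0 : Fin n → ℂ)

theorem integral_sqNorm (n : ℕ) : ∫ z, sqNorm z ∂(gaussBlock n) = n := by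
  simpa [sqNorm] using integral_sqNorm_add_smul (0 : Fin n → ℂ) 1

/-! ### Mutual information over the additive Gaussian noise channel -/

/-- The density of the output `d b + w` of the Gaussian noise channel with uniform input from the
codebook `d`, divided by its density given that codeword `b` was sent. -/
noncomputable def mixtureRatio {n : ℕ} {B : Type*} [Fintype B] (d : B → Fin n → ℂ) (b : B)
    (w : Fin n → ℂ) : ℝ :=
  𝔼 b', Real.exp (sqNorm w - sqNorm (w + (d b - d b')))

/-- The mutual information, in nats, between a uniform codeword of `d` and its observation in
Gaussian noise, as the mean of minus the logarithm of `mixtureRatio`. -/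
noncomputable def awgnInfo {n : ℕ} {B : Type*} [Fintype B] (d : B → Fin n → ℂ) : ℝ :=
  𝔼 b, ∫ w, -Real.log (mixtureRatio d b w) ∂(gaussBlock n)

section

variable {n : ℕ} {B : Type*} [Fintype B]

theorem continuous_mixtureRatio (d : B → Fin n → ℂ) (b : B) : Continuous (mixtureRatio d b) := by
  unfold mixtureRatio
  simp_rw [Fintype.expect_eq_sum_div_card]
  fun_prop

theorem inv_card_le_mixtureRatio (d : B → Fin n → ℂ) (b : B) (w : Fin n → ℂ) :
    (Fintype.card B : ℝ)⁻¹ ≤ mixtureRatio d b w := by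
  unfold mixtureRatio
  rw [Fintype.expect_eq_sum_div_card, inv_eq_one_div]
  gcongr
  have := Finset.single_le_sum (f := fun b' => Real.exp (sqNorm w - sqNorm (w + (d b - d b'))))
    (fun i _ => (Real.exp_pos _).le) (Finset.mem_univ b)
  simpa using this

theorem mixtureRatio_pos (d : B → Fin n → ℂ) (b : B) (w : Fin n → ℂ) :
    0 < mixtureRatio d b w :=
  have : Nonempty B := ⟨b⟩
  lt_of_lt_of_le (by positivity) (inv_card_le_mixtureRatio d b w)

theorem mixtureRatio_le_exp (d : B → Fin n → ℂ) (b : B) (w : Fin n → ℂ) :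
    mixtureRatio d b w ≤ Real.exp (sqNorm w) :=
  Finset.expect_le ⟨b, Finset.mem_univ b⟩ fun _ _ =>
    Real.exp_le_exp.2 (sub_le_self _ (sqNorm_nonneg _))

theorem integrable_log_mixtureRatio (d : B → Fin n → ℂ) (b : B) :
    Integrable (fun w => Real.log (mixtureRatio d b w)) (gaussBlock n) := by
  have hB : Nonempty B := ⟨b⟩
  refine Integrable.mono' ((integrable_sqNorm n).add (integrable_const (Real.log (Fintype.card B))))
    ((continuous_mixtureRatio d b).measurable.log.aestronglyMeasurable) (ae_of_all _ fun w => ?_)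
  have h1 := Real.log_le_log (by positivity) (inv_card_le_mixtureRatio d b w)
  have h2 := Real.log_le_log (mixtureRatio_pos d b w) (mixtureRatio_le_exp d b w)
  rw [Real.log_inv] at h1
  rw [Real.log_exp] at h2
  have h3 : 0 ≤ Real.log (Fintype.card B) := Real.log_natCast_nonneg _
  have h4 := sqNorm_nonneg w
  simp only [Pi.add_apply]
  rw [Real.norm_eq_abs, abs_le]
  constructor <;> linarith

/-- `mixtureRatio` as a function of the output `y` instead of the noise `y - d b`. -/
theorem mixtureRatio_sub (d : B → Fin n → ℂ) (b : B) (y : Fin n → ℂ) :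
    mixtureRatio d b (y - d b)
      = Real.exp (sqNorm (y - d b)) * 𝔼 b', Real.exp (-sqNorm (y - d b')) := by
  unfold mixtureRatio
  rw [Finset.mul_expect]
  refine Finset.expect_congr rfl fun b' _ => ?_
  rw [← Real.exp_add, sub_add_sub_cancel, sub_eq_add_neg]

theorem awgnInfo_add_const (d : B → Fin n → ℂ) (v : Fin n → ℂ) :
    awgnInfo (fun b => v + d b) = awgnInfo d := by
  simp [awgnInfo, mixtureRatio]

theorem awgnInfo_const [Nonempty B] (v : Fin n → ℂ) : awgnInfo (fun _ : B => v) = 0 := by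
  simp [awgnInfo, mixtureRatio]

/-- The output density of the Gaussian noise channel with codebook `d` integrates to one, up to the
normalization `π ^ n`. -/
theorem lintegral_expect_exp_neg_sqNorm [Nonempty B] (d : B → Fin n → ℂ) :
    ∫⁻ y : Fin n → ℂ, ENNReal.ofReal (𝔼 b, Real.exp (-sqNorm (y - d b)))
      = ENNReal.ofReal (Real.pi ^ n) := by
  have hB : (0 : ℝ) < Fintype.card B := by positivity
  simp_rw [Fintype.expect_eq_sum_div_card, div_eq_inv_mul]
  simp_rw [ENNReal.ofReal_mul (inv_nonneg.2 hB.le),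
    ENNReal.ofReal_sum_of_nonneg fun (b : B) _ => (Real.exp_pos _).le]
  rw [lintegral_const_mul _ (by fun_prop), lintegral_finsetSum _ fun b _ => by fun_prop]
  have : ∀ b, ∫⁻ y : Fin n → ℂ, ENNReal.ofReal (Real.exp (-sqNorm (y - d b)))
      = ENNReal.ofReal (Real.pi ^ n) := fun b => by
    simpa using lintegral_exp_neg_sqNorm_div (d b) one_pos
  simp_rw [this]
  rw [Finset.sum_const, nsmul_eq_mul, Finset.card_univ, ← mul_assoc, ← ENNReal.ofReal_natCast,
    ← ENNReal.ofReal_mul (inv_nonneg.2 hB.le), inv_mul_cancel₀ hB.ne', ENNReal.ofReal_one, one_mul]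

end

/-! ### Gibbs' inequality and changes of variables -/

/-- Gibbs' inequality for a uniform mixture of probability measures: log-likelihood ratios whose
exponentials have mean at most `1` have nonpositive mean. -/
theorem sum_integral_nonpos_of_sum_lintegral_exp_le {ι X : Type*} [Fintype ι] [MeasurableSpace X]
    {P : Measure X} [IsProbabilityMeasure P] {f : ι → X → ℝ} (hf : ∀ i, Integrable (f i) P)
    (h : ∑ i, ∫⁻ x, ENNReal.ofReal (Real.exp (f i x)) ∂P ≤ Fintype.card ι) :
    ∑ i, ∫ x, f i x ∂P ≤ 0 := by
  have hfin : ∀ i, ∫⁻ x, ENNReal.ofReal (Real.exp (f i x)) ∂P ≠ ∞ := fun i =>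
    ne_top_of_le_ne_top (ENNReal.natCast_ne_top _)
      ((Finset.single_le_sum (f := fun i => ∫⁻ x, ENNReal.ofReal (Real.exp (f i x)) ∂P)
        (fun _ _ => zero_le) (Finset.mem_univ i)).trans h)
  have hm : ∀ i, AEStronglyMeasurable (fun x => Real.exp (f i x)) P := fun i =>
    Real.continuous_exp.comp_aestronglyMeasurable (hf i).1
  have hexp : ∀ i, Integrable (fun x => Real.exp (f i x)) P := fun i =>
    (lintegral_ofReal_ne_top_iff_integrable (hm i) (ae_of_all _ fun _ => (Real.exp_pos _).le)).1
      (hfin i)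
  have hle : ∀ i, ∫ x, f i x ∂P ≤ (∫⁻ x, ENNReal.ofReal (Real.exp (f i x)) ∂P).toReal - 1 := by
    intro i
    rw [← integral_eq_lintegral_of_nonneg_ae (ae_of_all _ fun _ => (Real.exp_pos _).le) (hm i)]
    have : ∫ x, f i x ∂P ≤ ∫ x, (Real.exp (f i x) - 1) ∂P :=
      integral_mono (hf i) ((hexp i).sub (integrable_const _)) fun x => by
        have := Real.add_one_le_exp (f i x)
        simp only; linarith
    rwa [integral_sub (hexp i) (integrable_const _), integral_const, probReal_univ, one_smul] at this
  calc ∑ i, ∫ x, f i x ∂P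
      ≤ ∑ i, ((∫⁻ x, ENNReal.ofReal (Real.exp (f i x)) ∂P).toReal - 1) :=
        Finset.sum_le_sum fun i _ => hle i
    _ = (∑ i, ∫⁻ x, ENNReal.ofReal (Real.exp (f i x)) ∂P).toReal - Fintype.card ι := by
        rw [ENNReal.toReal_sum fun i _ => hfin i]; simp
    _ ≤ 0 := by
        have := ENNReal.toReal_mono (ENNReal.natCast_ne_top _) h
        simp only [ENNReal.toReal_natCast] at this
        linarith

theorem lintegral_gaussBlock {n : ℕ} {F : (Fin n → ℂ) → ℝ≥0∞} (hF : Measurable F)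
    (x : Fin n → ℂ) :
    ∫⁻ z, F z ∂(gaussBlock n) = ∫⁻ y : Fin n → ℂ,
      ENNReal.ofReal (Real.pi⁻¹ ^ n * Real.exp (-sqNorm (y - x))) * F (y - x) := by
  rw [gaussBlock_eq_withDensity, lintegral_withDensity_eq_lintegral_mul _ (by fun_prop) hF]
  exact (lintegral_sub_right_eq_self _ x).symm

theorem lintegral_gaussBlock_prod {n : ℕ} {F : (Fin n → ℂ) × (Fin n → ℂ) → ℝ≥0∞}
    (hF : Measurable F) (x u : Fin n → ℂ) :
    ∫⁻ z, F z ∂((gaussBlock n).prod (gaussBlock n)) = ∫⁻ p : (Fin n → ℂ) × (Fin n → ℂ),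
      ENNReal.ofReal (Real.pi⁻¹ ^ n * Real.exp (-sqNorm (p.1 - x))) *
        ENNReal.ofReal (Real.pi⁻¹ ^ n * Real.exp (-sqNorm (p.2 - u))) *
          F (p.1 - x, p.2 - u) := by
  rw [gaussBlock_eq_withDensity, prod_withDensity (by fun_prop) (by fun_prop),
    ← Measure.volume_eq_prod, lintegral_withDensity_eq_lintegral_mul _ (by fun_prop) hF]
  have : (volume : Measure ((Fin n → ℂ) × (Fin n → ℂ))).IsAddRightInvariant := by
    rw [Measure.volume_eq_prod]; exact Measure.prod.instIsAddRightInvariant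
  exact (lintegral_sub_right_eq_self _ (x, u)).symm

theorem awgnInfo_nonneg {n : ℕ} {B : Type*} [Fintype B] (d : B → Fin n → ℂ) :
    0 ≤ awgnInfo d := by
  have key : ∑ b, ∫ w, Real.log (mixtureRatio d b w) ∂(gaussBlock n) ≤ 0 := by
    refine sum_integral_nonpos_of_sum_lintegral_exp_le (integrable_log_mixtureRatio d) (le_of_eq ?_)
    have : ∀ b, ∫⁻ w, ENNReal.ofReal (Real.exp (Real.log (mixtureRatio d b w))) ∂(gaussBlock n)
        = 1 := by
      intro b
      have hB : Nonempty B := ⟨b⟩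
      simp_rw [Real.exp_log (mixtureRatio_pos d b _)]
      rw [lintegral_gaussBlock (continuous_mixtureRatio d b).measurable.ennreal_ofReal (d b)]
      have : ∀ y : Fin n → ℂ, ENNReal.ofReal (Real.pi⁻¹ ^ n * Real.exp (-sqNorm (y - d b))) *
          ENNReal.ofReal (mixtureRatio d b (y - d b)) = ENNReal.ofReal (Real.pi⁻¹ ^ n) *
            ENNReal.ofReal (𝔼 b', Real.exp (-sqNorm (y - d b'))) := by
        intro y
        rw [← ENNReal.ofReal_mul (by positivity), ← ENNReal.ofReal_mul (by positivity),
          mixtureRatio_sub, mul_assoc, ← mul_assoc (Real.exp _), ← Real.exp_add]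
        simp
      simp_rw [this]
      rw [lintegral_const_mul' _ _ ENNReal.ofReal_ne_top, lintegral_expect_exp_neg_sqNorm,
        ← ENNReal.ofReal_mul (by positivity), ← mul_pow, inv_mul_cancel₀ Real.pi_ne_zero]
      simp
    simp [this]
  unfold awgnInfo
  rw [Fintype.expect_eq_sum_div_card]
  simp_rw [integral_neg, Finset.sum_neg_distrib]
  exact div_nonneg (neg_nonneg.2 key) (Nat.cast_nonneg _)

/-! ### The genie-aided Fano inequality -/

@[fun_prop]
theorem measurable_expect {ι X : Type*} [Fintype ι] [MeasurableSpace X] {f : ι → X → ℝ}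
    (hf : ∀ i, Measurable (f i)) : Measurable fun x => 𝔼 i, f i x := by
  simp_rw [Fintype.expect_eq_sum_div_card]
  fun_prop

section

variable {n : ℕ} {A B C : Type*} [Fintype A] [Fintype B] [Fintype C]

/-- The logarithm of the likelihood ratio, in a fixed context, between a test law of (message,
observation, genie signal) and the true one, at noise `p = (z, w)`. The observation is `x c + z`
for message `b` and interference index `c`, and the genie signal is `d b + w`. Under the test law
the genie signal has its true marginal law, the observation is Gaussian of variance `v` about
`m + α • (genie signal)`, and `r` is the posterior probability of message `b` as a function of the
observation. Under the true law the message is uniform and the law of the observation is averaged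
over the interference. -/
noncomputable def testLogRatio (d : B → Fin n → ℂ) (x : C → Fin n → ℂ) (m : Fin n → ℂ) (α : ℂ)
    (v : ℝ) (r : (Fin n → ℂ) → ℝ) (b : B) (c : C) (p : (Fin n → ℂ) × (Fin n → ℂ)) : ℝ :=
  Real.log (r (x c + p.1)) + Real.log (Fintype.card B) + Real.log (mixtureRatio d b p.2)
    - Real.log (mixtureRatio x c p.1) + sqNorm p.1
    - sqNorm (x c + p.1 - m - α • (d b + p.2)) / v - n * Real.log v

/-- The noise density times the likelihood ratio, in terms of the observation `y` and the genie
signal `s`: a test density that does not involve `b` and `c`, times the posterior of `b` under `r`,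
times a multiple of the true posterior of `c`. -/
theorem exp_testLogRatio [Nonempty B] (d : B → Fin n → ℂ) (x : C → Fin n → ℂ) (m : Fin n → ℂ)
    (α : ℂ) {v : ℝ} (hv : 0 < v) {r : (Fin n → ℂ) → ℝ} (hr : ∀ y, 0 < r y) (b : B) (c : C)
    (y s : Fin n → ℂ) :
    (Real.pi⁻¹ ^ n * Real.exp (-sqNorm (y - x c))) * (Real.pi⁻¹ ^ n * Real.exp (-sqNorm (s - d b)))
      * Real.exp (testLogRatio d x m α v r b c (y - x c, s - d b))
    = (Fintype.card B * (Real.pi⁻¹ ^ n) ^ 2 * v⁻¹ ^ n * (𝔼 b', Real.exp (-sqNorm (s - d b'))) *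
        Real.exp (-(sqNorm (y - (m + α • s)) / v))) *
        (r y * (Real.exp (-sqNorm (y - x c)) / 𝔼 c', Real.exp (-sqNorm (y - x c')))) := by
  have hB : (0 : ℝ) < Fintype.card B := by positivity
  have h1 := mixtureRatio_pos d b (s - d b)
  have h2 := mixtureRatio_pos x c (y - x c)
  have h3 : Real.exp (n * Real.log v) = v ^ n := by
    rw [mul_comm, Real.exp_mul, Real.exp_log hv, Real.rpow_natCast]
  unfold testLogRatio
  simp only [add_sub_cancel]
  rw [sub_eq_add_neg _ (sqNorm _ / v), Real.exp_sub, Real.exp_add, Real.exp_add, Real.exp_sub,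
    Real.exp_add, Real.exp_add, Real.exp_log (hr y), Real.exp_log hB, Real.exp_log h1,
    Real.exp_log h2, h3, mixtureRatio_sub, mixtureRatio_sub, ← sub_sub, Real.exp_neg (sqNorm (s - d b)),
    Real.exp_neg (sqNorm (y - x c))]
  have hc : Nonempty C := ⟨c⟩
  have h4 : 0 < 𝔼 c', Real.exp (-sqNorm (y - x c')) :=
    Finset.expect_pos (fun _ _ => Real.exp_pos _) Finset.univ_nonempty
  have h5 := Real.exp_pos (sqNorm (s - d b))
  have h6 := Real.exp_pos (sqNorm (y - x c))
  have h7 : 0 < v ^ n := by positivity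
  rw [inv_pow v]
  generalize (𝔼 c', Real.exp (-sqNorm (y - x c'))) = Q at *
  generalize (𝔼 c', Real.exp (-sqNorm (s - d c'))) = P at *
  field_simp

theorem lintegral_test_density [Nonempty B] (d : B → Fin n → ℂ) (m : Fin n → ℂ) (α : ℂ) {v : ℝ}
    (hv : 0 < v) :
    ∫⁻ p : (Fin n → ℂ) × (Fin n → ℂ), ENNReal.ofReal ((𝔼 b', Real.exp (-sqNorm (p.2 - d b'))) *
      Real.exp (-(sqNorm (p.1 - (m + α • p.2)) / v)))
      = ENNReal.ofReal (Real.pi ^ n * (Real.pi * v) ^ n) := by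
  have hP0 : ∀ s : Fin n → ℂ, 0 ≤ 𝔼 b', Real.exp (-sqNorm (s - d b')) := fun s =>
    Finset.expect_nonneg fun _ _ => (Real.exp_pos _).le
  rw [Measure.volume_eq_prod, lintegral_prod_symm' _ (by fun_prop)]
  simp only [ENNReal.ofReal_mul (hP0 _)]
  simp_rw [lintegral_const_mul' _ _ ENNReal.ofReal_ne_top, lintegral_exp_neg_sqNorm_div _ hv]
  rw [lintegral_mul_const' _ _ ENNReal.ofReal_ne_top, lintegral_expect_exp_neg_sqNorm,
    ← ENNReal.ofReal_mul (by positivity)]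

/-- The likelihood ratio has mean `1` under the true law. The changes of variables turn the noise
into the received signals, where the sums over `c` and `b` of the two posteriors can be taken
pointwise. -/
theorem sum_lintegral_exp_testLogRatio [Nonempty B] [Nonempty C] (d : B → Fin n → ℂ)
    (x : B → C → Fin n → ℂ) (m : Fin n → ℂ) (α : ℂ) {v : ℝ} (hv : 0 < v)
    {r : B → (Fin n → ℂ) → ℝ} (hr : ∀ b y, 0 < r b y) (hrm : ∀ b, Measurable (r b))
    (hr1 : ∀ y, ∑ b, r b y = 1) :
    ∑ b, ∑ c, ∫⁻ p, ENNReal.ofReal (Real.exp (testLogRatio d (x b) m α v (r b) b c p))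
        ∂((gaussBlock n).prod (gaussBlock n))
      = ENNReal.ofReal (Fintype.card B * Fintype.card C) := by
  have hm : ∀ b c, Measurable fun p : (Fin n → ℂ) × (Fin n → ℂ) =>
      testLogRatio d (x b) m α v (r b) b c p := by
    intro b c
    have h1 := (continuous_mixtureRatio d b).measurable
    have h2 := (continuous_mixtureRatio (x b) c).measurable
    have h3 := hrm b
    unfold testLogRatio
    fun_prop
  have hP0 : ∀ s : Fin n → ℂ, 0 ≤ 𝔼 b', Real.exp (-sqNorm (s - d b')) := fun s =>
    Finset.expect_nonneg fun _ _ => (Real.exp_pos _).le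
  have hQ0 : ∀ b (y : Fin n → ℂ), 0 < 𝔼 c', Real.exp (-sqNorm (y - x b c')) := fun b y =>
    Finset.expect_pos (fun _ _ => Real.exp_pos _) Finset.univ_nonempty
  let G : B → C → (Fin n → ℂ) × (Fin n → ℂ) → ℝ := fun b c p =>
    (Fintype.card B * (Real.pi⁻¹ ^ n) ^ 2 * v⁻¹ ^ n *
        (𝔼 b', Real.exp (-sqNorm (p.2 - d b'))) *
        Real.exp (-(sqNorm (p.1 - (m + α • p.2)) / v))) *
        (r b p.1 * (Real.exp (-sqNorm (p.1 - x b c)) / 𝔼 c', Real.exp (-sqNorm (p.1 - x b c'))))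
  have hG0 : ∀ b c p, 0 ≤ G b c p := fun b c p => by
    have := hP0 p.2
    have := hQ0 b p.1
    have := hr b p.1
    positivity
  have hGm : ∀ b c, Measurable (G b c) := fun b c => by
    have := hrm b
    simp only [G]
    fun_prop
  have hshift : ∀ b c, ∫⁻ p, ENNReal.ofReal (Real.exp (testLogRatio d (x b) m α v (r b) b c p))
        ∂((gaussBlock n).prod (gaussBlock n)) = ∫⁻ p, ENNReal.ofReal (G b c p) := by
    intro b c
    rw [lintegral_gaussBlock_prod (hm b c).exp.ennreal_ofReal (x b c) (d b)]
    refine lintegral_congr fun p => ?_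
    rw [← ENNReal.ofReal_mul (by positivity), ← ENNReal.ofReal_mul (by positivity),
      exp_testLogRatio d (x b) m α hv (hr b) b c p.1 p.2]
  have hsum : ∀ p, ∑ b, ∑ c, G b c p = Fintype.card B * Fintype.card C *
      ((Real.pi⁻¹ ^ n) ^ 2 * v⁻¹ ^ n) * ((𝔼 b', Real.exp (-sqNorm (p.2 - d b'))) *
      Real.exp (-(sqNorm (p.1 - (m + α • p.2)) / v))) := by
    intro p
    have hc : ∀ b, ∑ c, Real.exp (-sqNorm (p.1 - x b c)) /
        (𝔼 c', Real.exp (-sqNorm (p.1 - x b c'))) = Fintype.card C := fun b => by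
      rw [← Finset.sum_div, div_eq_iff (hQ0 b p.1).ne', Fintype.expect_eq_sum_div_card]
      field_simp
    simp only [G]
    simp_rw [← Finset.mul_sum, hc, ← Finset.sum_mul, hr1]
    ring
  simp_rw [hshift]
  simp_rw [← lintegral_finsetSum _ fun c _ => (hGm _ c).ennreal_ofReal]
  rw [← lintegral_finsetSum _ fun b _ => Finset.measurable_sum _ fun c _ =>
    (hGm b c).ennreal_ofReal]
  simp_rw [← ENNReal.ofReal_sum_of_nonneg fun c (_ : c ∈ Finset.univ) => hG0 _ c _]
  simp_rw [← ENNReal.ofReal_sum_of_nonneg fun b (_ : b ∈ Finset.univ) =>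
    Finset.sum_nonneg fun c _ => hG0 b c _, hsum]
  have hk : (0 : ℝ) ≤ Fintype.card B * Fintype.card C * ((Real.pi⁻¹ ^ n) ^ 2 * v⁻¹ ^ n) := by
    positivity
  simp_rw [ENNReal.ofReal_mul hk]
  rw [lintegral_const_mul' _ _ ENNReal.ofReal_ne_top, lintegral_test_density d m α hv,
    ← ENNReal.ofReal_mul hk]
  congr 1
  have := Real.pi_pos
  simp only [mul_pow, inv_pow]
  field_simp

theorem integrable_sqNorm_prod (x : Fin n → ℂ) (α : ℂ) :
    Integrable (fun p : (Fin n → ℂ) × (Fin n → ℂ) => sqNorm (x + p.1 - α • p.2))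
      ((gaussBlock n).prod (gaussBlock n)) := by
  have h1 := ((integrable_sqNorm n).const_mul 2).comp_fst (gaussBlock n)
  have h2 := ((integrable_sqNorm_add_smul x (-α)).const_mul 2).comp_snd (gaussBlock n)
  refine Integrable.mono' (h1.add h2) (by fun_prop) (ae_of_all _ fun p => ?_)
  rw [Real.norm_of_nonneg (sqNorm_nonneg _)]
  simp only [Pi.add_apply, sqNorm, Finset.mul_sum, ← Finset.sum_add_distrib]
  refine Finset.sum_le_sum fun t _ => ?_
  have h3 := norm_add_le (p.1 t) (x t + -α * p.2 t)
  have h4 : p.1 t + (x t + -α * p.2 t) = x t + p.1 t - α * p.2 t := by ring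
  rw [h4] at h3
  simp only [Pi.sub_apply, Pi.add_apply, Pi.smul_apply, smul_eq_mul]
  nlinarith [sq_nonneg (‖p.1 t‖ - ‖x t + -α * p.2 t‖), norm_nonneg (x t + p.1 t - α * p.2 t)]

theorem integral_sqNorm_prod (x : Fin n → ℂ) (α : ℂ) :
    ∫ p, sqNorm (x + p.1 - α • p.2) ∂((gaussBlock n).prod (gaussBlock n))
      = sqNorm x + n * (1 + ‖α‖ ^ 2) := by
  rw [integral_prod_symm _ (integrable_sqNorm_prod x α)]
  have h : ∀ w : Fin n → ℂ, ∫ z, sqNorm (x + z - α • w) ∂(gaussBlock n)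
      = sqNorm (x + (-α) • w) + n := by
    intro w
    have := integral_sqNorm_add_smul (x + (-α) • w) 1
    simp only [one_smul, norm_one, one_pow, mul_one] at this
    rw [← this]
    congr 1 with z
    congr 1
    rw [neg_smul]; abel
  simp_rw [h]
  rw [integral_add (integrable_sqNorm_add_smul x (-α)) (integrable_const _),
    integral_sqNorm_add_smul]
  simp
  ring

theorem integrable_log_of_le_of_le {X : Type*} [MeasurableSpace X] {P : Measure X}
    [IsFiniteMeasure P] {f : X → ℝ} (hf : Measurable f) {δ : ℝ} (hδ : 0 < δ) (h : ∀ x, δ ≤ f x)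
    (h1 : ∀ x, f x ≤ 1) : Integrable (fun x => Real.log (f x)) P := by
  refine Integrable.mono' (integrable_const (-Real.log δ)) hf.log.aestronglyMeasurable
    (ae_of_all _ fun x => ?_)
  rw [Real.norm_of_nonpos (Real.log_nonpos (hδ.le.trans (h x)) (h1 x))]
  exact neg_le_neg (Real.log_le_log hδ (h x))

variable [Nonempty A] [Nonempty B] [Nonempty C]

/-- Gibbs' inequality for the test law of `testLogRatio`, averaged over the context `a`. -/
theorem log_card_add_expect_log_posterior_le (d : A → B → Fin n → ℂ) (x : A → B → C → Fin n → ℂ)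
    (m : A → Fin n → ℂ) (α : ℂ) {v : ℝ} (hv : 0 < v) {r : A → B → (Fin n → ℂ) → ℝ} {δ : ℝ}
    (hδ : 0 < δ) (hr : ∀ a b y, δ ≤ r a b y) (hrm : ∀ a b, Measurable (r a b))
    (hr1 : ∀ a y, ∑ b, r a b y = 1)
    (hpow : (𝔼 a, 𝔼 b, 𝔼 c, sqNorm (x a b c - m a - α • d a b)) + n * (1 + ‖α‖ ^ 2) ≤ n * v) :
    Real.log (Fintype.card B) +
      (𝔼 a, 𝔼 b, 𝔼 c, ∫ z, Real.log (r a b (x a b c + z)) ∂(gaussBlock n)) ≤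
      (𝔼 a, awgnInfo (d a)) - (𝔼 a, 𝔼 b, awgnInfo (x a b)) + n * Real.log v := by
  have hr0 : ∀ a b y, 0 < r a b y := fun a b y => hδ.trans_le (hr a b y)
  have hrle : ∀ a b y, r a b y ≤ 1 := fun a b y => by
    rw [← hr1 a y]
    exact Finset.single_le_sum (f := fun b => r a b y) (fun i _ => (hr0 a i y).le)
      (Finset.mem_univ b)
  have ir : ∀ a b c, Integrable (fun z => Real.log (r a b (x a b c + z))) (gaussBlock n) :=
    fun a b c => integrable_log_of_le_of_le ((hrm a b).comp (measurable_const_add _)) hδ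
      (fun _ => hr _ _ _) fun _ => hrle _ _ _
  have hsq : ∀ a b c (p : (Fin n → ℂ) × (Fin n → ℂ)), x a b c + p.1 - m a - α • (d a b + p.2)
      = (x a b c - m a - α • d a b) + p.1 - α • p.2 := fun a b c p => by rw [smul_add]; abel
  have i1 := fun a b c => (ir a b c).comp_fst (gaussBlock n)
  have i2 : ∀ a b, Integrable (fun p : (Fin n → ℂ) × (Fin n → ℂ) =>
      Real.log (mixtureRatio (d a) b p.2)) ((gaussBlock n).prod (gaussBlock n)) :=
    fun a b => (integrable_log_mixtureRatio (d a) b).comp_snd (gaussBlock n)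
  have i3 : ∀ a b c, Integrable (fun p : (Fin n → ℂ) × (Fin n → ℂ) =>
      Real.log (mixtureRatio (x a b) c p.1)) ((gaussBlock n).prod (gaussBlock n)) :=
    fun a b c => (integrable_log_mixtureRatio (x a b) c).comp_fst (gaussBlock n)
  have i4 : Integrable (fun p : (Fin n → ℂ) × (Fin n → ℂ) => sqNorm p.1)
      ((gaussBlock n).prod (gaussBlock n)) := (integrable_sqNorm n).comp_fst (gaussBlock n)
  have i5 := fun a b c => (integrable_sqNorm_prod (x a b c - m a - α • d a b) α).div_const v
  have j1 := fun a b c => (i1 a b c).add (integrable_const (Real.log (Fintype.card B)))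
  have j2 := fun a b c => (j1 a b c).add (i2 a b)
  have j3 := fun a b c => (j2 a b c).sub (i3 a b c)
  have j4 := fun a b c => (j3 a b c).add i4
  have j5 := fun a b c => (j4 a b c).sub (i5 a b c)
  have j6 := fun a b c => (j5 a b c).sub (integrable_const (n * Real.log v))
  have hI : ∀ a b c, Integrable (testLogRatio (d a) (x a b) (m a) α v (r a b) b c)
      ((gaussBlock n).prod (gaussBlock n)) := by
    intro a b c
    refine (j6 a b c).congr (ae_of_all _ fun p => ?_)
    simp only [testLogRatio, hsq, Pi.add_apply, Pi.sub_apply]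
  have hval : ∀ a b c, ∫ p, testLogRatio (d a) (x a b) (m a) α v (r a b) b c p
      ∂((gaussBlock n).prod (gaussBlock n)) =
      ∫ z, Real.log (r a b (x a b c + z)) ∂(gaussBlock n) + Real.log (Fintype.card B)
      + ∫ w, Real.log (mixtureRatio (d a) b w) ∂(gaussBlock n)
      - ∫ z, Real.log (mixtureRatio (x a b) c z) ∂(gaussBlock n) + n
      - (sqNorm (x a b c - m a - α • d a b) + n * (1 + ‖α‖ ^ 2)) / v - n * Real.log v := by
    intro a b c
    have e := integral_sub' (j5 a b c) (integrable_const (n * Real.log v))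
    rw [integral_sub' (j4 a b c) (i5 a b c),
      integral_add' (j3 a b c) i4, integral_sub' (j2 a b c) (i3 a b c),
      integral_add' (j1 a b c) (i2 a b), integral_add' (i1 a b c) (integrable_const _),
      integral_div, integral_sqNorm_prod,
      integral_fun_fst (fun z => Real.log (r a b (x a b c + z))),
      integral_fun_snd (fun w => Real.log (mixtureRatio (d a) b w)),
      integral_fun_fst (fun z => Real.log (mixtureRatio (x a b) c z)),
      integral_fun_fst (fun z : Fin n → ℂ => sqNorm z), integral_sqNorm] at e
    refine (integral_congr_ae (ae_of_all _ fun p => ?_)).trans (e.trans ?_)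
    · simp only [testLogRatio, hsq, Pi.add_apply, Pi.sub_apply]
    · simp
  have hG := sum_integral_nonpos_of_sum_lintegral_exp_le (ι := A × B × C)
    (f := fun i => testLogRatio (d i.1) (x i.1 i.2.1) (m i.1) α v (r i.1 i.2.1) i.2.1 i.2.2)
    (P := (gaussBlock n).prod (gaussBlock n)) (fun i => hI _ _ _) (by
      rw [Fintype.sum_prod_type]
      simp_rw [Fintype.sum_prod_type]
      simp_rw [fun a => sum_lintegral_exp_testLogRatio (d a) (x a) (m a) α hv (hr0 a) (hrm a) (hr1 a)]
      rw [Finset.sum_const, nsmul_eq_mul, Finset.card_univ, ← ENNReal.ofReal_natCast,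
        ← ENNReal.ofReal_mul (by positivity), ← ENNReal.ofReal_natCast (Fintype.card (A × B × C))]
      simp [Fintype.card_prod])
  have hE : (𝔼 a, 𝔼 b, 𝔼 c, ∫ p, testLogRatio (d a) (x a b) (m a) α v (r a b) b c p
      ∂((gaussBlock n).prod (gaussBlock n))) ≤ 0 := by
    simp_rw [Fintype.expect_eq_sum_div_card, ← Finset.sum_div]
    rw [Fintype.sum_prod_type] at hG
    simp_rw [Fintype.sum_prod_type] at hG
    exact div_nonpos_of_nonpos_of_nonneg (div_nonpos_of_nonpos_of_nonneg
      (div_nonpos_of_nonpos_of_nonneg hG (by positivity)) (by positivity)) (by positivity)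
  simp_rw [hval] at hE
  simp_rw [Finset.expect_sub_distrib, Finset.expect_add_distrib, ← Finset.expect_div,
    Finset.expect_sub_distrib, Finset.expect_add_distrib, Fintype.expect_const] at hE
  unfold awgnInfo
  simp_rw [integral_neg, Finset.expect_neg_distrib]
  have hq : ((𝔼 a, 𝔼 b, 𝔼 c, sqNorm (x a b c - m a - α • d a b)) + n * (1 + ‖α‖ ^ 2)) / v ≤ n := by
    rw [div_le_iff₀ hv]; exact hpow
  linarith

/-- The genie-aided Fano inequality. Given a context `a`, a message `b` and an interference
index `c`, all uniform, the receiver sees `x a b c` in Gaussian noise, and a genie shows `d a b` in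
independent Gaussian noise. The posterior of `log_card_add_expect_log_posterior_le` trusts the
decoder `g` with probability `1/2` and is uniform otherwise. -/
theorem genie_fano (d : A → B → Fin n → ℂ) (x : A → B → C → Fin n → ℂ) (m : A → Fin n → ℂ) (α : ℂ)
    {v : ℝ} (hv : 0 < v) (g : A → (Fin n → ℂ) → B) (hg : ∀ a b, MeasurableSet {y | g a y = b})
    (hpow : (𝔼 a, 𝔼 b, 𝔼 c, sqNorm (x a b c - m a - α • d a b)) + n * (1 + ‖α‖ ^ 2) ≤ n * v) :
    Real.log (Fintype.card B) ≤ Real.log 2 +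
      (𝔼 a, 𝔼 b, 𝔼 c, (gaussBlock n).real {z | g a (x a b c + z) ≠ b}) *
        Real.log (Fintype.card B) +
      (𝔼 a, awgnInfo (d a)) - (𝔼 a, 𝔼 b, awgnInfo (x a b)) + n * Real.log v := by
  classical
  have hB : (0 : ℝ) < Fintype.card B := by positivity
  let r : A → B → (Fin n → ℂ) → ℝ := fun a b y =>
    (if g a y = b then 2⁻¹ else 0) + 2⁻¹ * (Fintype.card B : ℝ)⁻¹
  have hδ : (0 : ℝ) < 2⁻¹ * (Fintype.card B : ℝ)⁻¹ := by positivity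
  have hr : ∀ a b y, 2⁻¹ * (Fintype.card B : ℝ)⁻¹ ≤ r a b y := fun a b y => by
    simp only [r]; split_ifs <;> linarith
  have hrm : ∀ a b, Measurable (r a b) := fun a b =>
    (Measurable.ite (hg a b) measurable_const measurable_const).add_const _
  have hr1 : ∀ a y, ∑ b, r a b y = 1 := fun a y => by
    simp only [r, Finset.sum_add_distrib, Finset.sum_ite_eq, Finset.mem_univ, if_true,
      Finset.sum_const, Finset.card_univ, nsmul_eq_mul]
    field_simp
    norm_num
  have hmain := log_card_add_expect_log_posterior_le d x m α hv hδ hr hrm hr1 hpow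
  have hlow : ∀ a b c, -Real.log 2 - (gaussBlock n).real {z | g a (x a b c + z) ≠ b} *
      Real.log (Fintype.card B) ≤ ∫ z, Real.log (r a b (x a b c + z)) ∂(gaussBlock n) := by
    intro a b c
    have hS : MeasurableSet {z | g a (x a b c + z) ≠ b} :=
      (measurable_const_add (x a b c) (hg a b)).compl
    have hrle : ∀ y, r a b y ≤ 1 := fun y => by
      rw [← hr1 a y]
      exact Finset.single_le_sum (f := fun b => r a b y) (fun i _ => (hδ.le.trans (hr a i y)))
        (Finset.mem_univ b)
    have hint : Integrable (fun z => Real.log (r a b (x a b c + z))) (gaussBlock n) :=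
      integrable_log_of_le_of_le ((hrm a b).comp (measurable_const_add _)) hδ
        (fun _ => hr _ _ _) fun _ => hrle _
    have hind : Integrable ({z | g a (x a b c + z) ≠ b}.indicator
        fun _ => Real.log (Fintype.card B)) (gaussBlock n) := (integrable_const _).indicator hS
    calc _ = ∫ z, (-Real.log 2 - {z | g a (x a b c + z) ≠ b}.indicator
          (fun _ => Real.log (Fintype.card B)) z) ∂(gaussBlock n) := by
          rw [integral_sub (integrable_const _) hind, integral_indicator_const _ hS]
          simp
      _ ≤ _ := by
          refine integral_mono ((integrable_const _).sub hind) hint fun z => ?_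
          by_cases hz : g a (x a b c + z) = b
          · rw [Set.indicator_of_notMem (by simpa using hz), sub_zero, ← Real.log_inv]
            refine Real.log_le_log (by norm_num) ?_
            simp only [r, hz, if_true]
            linarith
          · simp only [r]
            rw [Set.indicator_of_mem hz, if_neg hz, zero_add,
              Real.log_mul (by norm_num) (by positivity), Real.log_inv, Real.log_inv]
            exact le_of_eq (by ring)
  have hlow' : -Real.log 2 - (𝔼 a, 𝔼 b, 𝔼 c, (gaussBlock n).real {z | g a (x a b c + z) ≠ b}) *
      Real.log (Fintype.card B) ≤
      𝔼 a, 𝔼 b, 𝔼 c, ∫ z, Real.log (r a b (x a b c + z)) ∂(gaussBlock n) := by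
    have := Finset.expect_le_expect fun a (_ : a ∈ Finset.univ) =>
      Finset.expect_le_expect fun b (_ : b ∈ Finset.univ) =>
      Finset.expect_le_expect fun c (_ : c ∈ Finset.univ) => hlow a b c
    simpa [Finset.expect_sub_distrib, ← Finset.expect_mul] using this
  linarith

end

/-! ### Second moments of the codewords -/

theorem expect_re_mul {C : Type*} [Fintype C] (k : ℂ) (f : C → ℂ) :
    𝔼 c, (k * f c).re = (k * 𝔼 c, f c).re := by
  simp_rw [Fintype.expect_eq_sum_div_card, ← mul_div_assoc, Complex.div_natCast_re, Finset.mul_sum,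
    Complex.re_sum]

theorem expect_norm_add_mul_sub_mean_sq_le {C : Type*} [Fintype C] [Nonempty C] (u q : ℂ)
    (f : C → ℂ) :
    𝔼 c, ‖u + q * (f c - 𝔼 c', f c')‖ ^ 2 ≤ ‖u‖ ^ 2 + ‖q‖ ^ 2 * 𝔼 c, ‖f c‖ ^ 2 := by
  set μ := 𝔼 c', f c' with hμ
  have h : ∀ c, ‖u + q * (f c - μ)‖ ^ 2 = ‖u - q * μ‖ ^ 2 + ‖q‖ ^ 2 * ‖f c‖ ^ 2
      + 2 * (starRingEnd ℂ (u - q * μ) * q * f c).re := fun c => by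
    rw [← norm_add_mul_sq]; ring_nf
  simp_rw [h, Finset.expect_add_distrib, ← Finset.mul_expect, expect_re_mul, Fintype.expect_const]
  rw [← hμ]
  have h2 := norm_add_mul_sq (u - q * μ) q μ
  rw [sub_add_cancel] at h2
  nlinarith [mul_nonneg (sq_nonneg ‖q‖) (sq_nonneg ‖μ‖)]

/-- An independent signal, centred at its mean, adds no more than its own power. -/
theorem expect_sqNorm_add_smul_sub_mean_le {n : ℕ} {C : Type*} [Fintype C] [Nonempty C]
    (u : Fin n → ℂ) (q : ℂ) (f : C → Fin n → ℂ) :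
    𝔼 c, sqNorm (u + q • (f c - fun t => 𝔼 c', f c' t))
      ≤ sqNorm u + ‖q‖ ^ 2 * 𝔼 c, sqNorm (f c) := by
  unfold sqNorm
  rw [Finset.expect_sum_comm, Finset.expect_sum_comm, Finset.mul_sum, ← Finset.sum_add_distrib]
  exact Finset.sum_le_sum fun t _ => expect_norm_add_mul_sub_mean_sq_le (u t) q fun c => f c t

theorem sqNorm_smul {n : ℕ} (k : ℂ) (x : Fin n → ℂ) : sqNorm (k • x) = ‖k‖ ^ 2 * sqNorm x := by
  simp [sqNorm, mul_pow, Finset.mul_sum]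

theorem sqNorm_smul_add_smul_le {n : ℕ} (h k : ℂ) (x y : Fin n → ℂ) :
    sqNorm (h • x + k • y) ≤ (‖h‖ + ‖k‖) * (‖h‖ * sqNorm x + ‖k‖ * sqNorm y) := by
  unfold sqNorm
  rw [Finset.mul_sum, Finset.mul_sum, ← Finset.sum_add_distrib, Finset.mul_sum]
  refine Finset.sum_le_sum fun t _ => ?_
  have h1 := norm_add_le (h * x t) (k * y t)
  rw [norm_mul, norm_mul] at h1
  have h2 : ‖h * x t + k * y t‖ ^ 2 ≤ (‖h‖ * ‖x t‖ + ‖k‖ * ‖y t‖) ^ 2 :=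
    pow_le_pow_left₀ (norm_nonneg _) h1 2
  have h3 := mul_nonneg (mul_nonneg (norm_nonneg h) (norm_nonneg k)) (sq_nonneg (‖x t‖ - ‖y t‖))
  simp only [Pi.add_apply, Pi.smul_apply, smul_eq_mul]
  nlinarith

/-- The coefficient of the linear minimum mean square error estimate of `h X` from `c X + W`, for
`X` and `W` of unit variance. -/
noncomputable def mmseCoeff (h c : ℂ) : ℂ := h * starRingEnd ℂ c / (1 + ‖c‖ ^ 2 : ℝ)

theorem sub_mmseCoeff_mul (h c : ℂ) : h - mmseCoeff h c * c = h / (1 + ‖c‖ ^ 2 : ℝ) := by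
  have h0 : ((1 + ‖c‖ ^ 2 : ℝ) : ℂ) ≠ 0 := by
    exact_mod_cast (by positivity : (1 + ‖c‖ ^ 2 : ℝ) ≠ 0)
  have h1 : starRingEnd ℂ c * c = ((‖c‖ ^ 2 : ℝ) : ℂ) := by
    rw [mul_comm, Complex.mul_conj, Complex.normSq_eq_norm_sq]
  rw [mmseCoeff, div_mul_eq_mul_div, mul_assoc, h1]
  field_simp
  push_cast
  ring

/-- The minimum mean square error, with the variance `1` of the observation noise added. -/
theorem mmse_eq (h c : ℂ) :
    ‖h - mmseCoeff h c * c‖ ^ 2 + (1 + ‖mmseCoeff h c‖ ^ 2) = 1 + ‖h‖ ^ 2 / (1 + ‖c‖ ^ 2) := by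
  have h0 : (0 : ℝ) < 1 + ‖c‖ ^ 2 := by positivity
  rw [sub_mmseCoeff_mul, mmseCoeff, norm_div, norm_div, norm_mul, Complex.norm_real,
    RCLike.norm_conj, Real.norm_of_nonneg h0.le]
  field_simp
  ring

/-! ### Rate bounds at one receiver -/

section

variable {n : ℕ} {M0 M1 M2 : Type*} [Fintype M0] [Fintype M1] [Fintype M2]

/-- The conditional mutual information, in nats, between the private message and the codeword
scaled by `c` and observed in Gaussian noise, given the common message. -/
noncomputable def privateInfo (c : ℂ) (x : M0 → M1 → Fin n → ℂ) : ℝ :=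
  𝔼 m0, awgnInfo fun m1 => c • x m0 m1

theorem privateInfo_nonneg (c : ℂ) (x : M0 → M1 → Fin n → ℂ) : 0 ≤ privateInfo c x :=
  Finset.expect_nonneg fun _ _ => awgnInfo_nonneg _

theorem privateInfo_zero [Nonempty M1] (x : M0 → M1 → Fin n → ℂ) : privateInfo 0 x = 0 := by
  simp [privateInfo, awgnInfo_const]

variable [Nonempty M0] [Nonempty M1] [Nonempty M2] {h k : ℂ} {x1 : M0 → M1 → Fin n → ℂ}
  {x2 : M0 → M2 → Fin n → ℂ} {g : (Fin n → ℂ) → M0 × M1} {ε : ℝ}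

/-- The genie-aided bound with the interference unknown: its information about the interfering
message is subtracted. The test law is centred at the conditional mean of the interference given
the common message, which removes the correlation of the two codewords. -/
theorem log_card_le_of_genie (c : ℂ) (hg : ∀ m, MeasurableSet {y | g y = m})
    (hx1 : 𝔼 m0, 𝔼 m1, sqNorm (x1 m0 m1) ≤ n) (hx2 : 𝔼 m0, 𝔼 m2, sqNorm (x2 m0 m2) ≤ n)
    (hε : (𝔼 m0, 𝔼 m1, 𝔼 m2, (gaussBlock n).real
      {z | g (h • x1 m0 m1 + k • x2 m0 m2 + z) ≠ (m0, m1)}) ≤ ε) :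
    Real.log (Fintype.card M1) ≤ Real.log 2 + ε * Real.log (Fintype.card M1) + privateInfo c x1
      - privateInfo k x2 + n * Real.log (1 + (‖k‖ ^ 2 + ‖h‖ ^ 2 / (1 + ‖c‖ ^ 2))) := by
  have hF := genie_fano (fun m0 m1 => c • x1 m0 m1) (fun m0 m1 m2 => h • x1 m0 m1 + k • x2 m0 m2)
    (fun m0 => k • fun t => 𝔼 m2, x2 m0 m2 t) (mmseCoeff h c)
    (v := 1 + (‖k‖ ^ 2 + ‖h‖ ^ 2 / (1 + ‖c‖ ^ 2))) (by positivity) (fun _ y => (g y).2)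
    (fun _ m1 => by
      have : {y | (g y).2 = m1} = ⋃ m0, {y | g y = (m0, m1)} := by
        ext y; simp [Prod.ext_iff]
      rw [this]
      exact MeasurableSet.iUnion fun m0 => hg _) ?_
  · simp only [awgnInfo_add_const] at hF
    have hle : (𝔼 m0, 𝔼 m1, 𝔼 m2, (gaussBlock n).real
        {z | (g (h • x1 m0 m1 + k • x2 m0 m2 + z)).2 ≠ m1}) ≤ ε := by
      refine le_trans ?_ hε
      refine Finset.expect_le_expect fun m0 _ => Finset.expect_le_expect fun m1 _ =>
        Finset.expect_le_expect fun m2 _ => measureReal_mono fun z hz hc => hz ?_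
      rw [hc]
    have hlog : 0 ≤ Real.log (Fintype.card M1) := Real.log_natCast_nonneg _
    have := mul_le_mul_of_nonneg_right hle hlog
    simp only [Fintype.expect_const] at hF
    unfold privateInfo
    linarith
  · have hrew : ∀ m0 m1 m2, h • x1 m0 m1 + k • x2 m0 m2 - k • (fun t => 𝔼 m2, x2 m0 m2 t)
        - mmseCoeff h c • c • x1 m0 m1
        = (h - mmseCoeff h c * c) • x1 m0 m1 + k • (x2 m0 m2 - fun t => 𝔼 m2, x2 m0 m2 t) := by
      intro m0 m1 m2
      rw [sub_smul, smul_sub, mul_smul]; abel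
    have hle : 𝔼 m0, 𝔼 m1, 𝔼 m2, sqNorm (h • x1 m0 m1 + k • x2 m0 m2 -
        k • (fun t => 𝔼 m2, x2 m0 m2 t) - mmseCoeff h c • c • x1 m0 m1)
        ≤ 𝔼 m0, 𝔼 m1, (‖h - mmseCoeff h c * c‖ ^ 2 * sqNorm (x1 m0 m1) +
          ‖k‖ ^ 2 * 𝔼 m2, sqNorm (x2 m0 m2)) := by
      refine Finset.expect_le_expect fun m0 _ => Finset.expect_le_expect fun m1 _ => ?_
      simp_rw [hrew, ← sqNorm_smul]
      exact expect_sqNorm_add_smul_sub_mean_le _ k (x2 m0)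
    simp_rw [Finset.expect_add_distrib, Fintype.expect_const, ← Finset.mul_expect] at hle
    have e := mmse_eq h c
    have h1 := mul_le_mul_of_nonneg_left hx1 (sq_nonneg ‖h - mmseCoeff h c * c‖)
    have h2 := mul_le_mul_of_nonneg_left hx2 (sq_nonneg ‖k‖)
    have e2 : (n : ℝ) * (1 + (‖k‖ ^ 2 + ‖h‖ ^ 2 / (1 + ‖c‖ ^ 2)))
        = ‖h - mmseCoeff h c * c‖ ^ 2 * n + ‖k‖ ^ 2 * n + n * (1 + ‖mmseCoeff h c‖ ^ 2) := by
      linear_combination (-(n : ℝ)) * e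
    rw [e2]
    linarith

/-- The genie-aided bound with the interfering codeword given to the receiver. The context is the
pair of the common and the interfering message. -/
theorem log_card_le_of_genie_of_interference (c : ℂ) (hg : ∀ m, MeasurableSet {y | g y = m})
    (hx1 : 𝔼 m0, 𝔼 m1, sqNorm (x1 m0 m1) ≤ n)
    (hε : (𝔼 m0, 𝔼 m1, 𝔼 m2, (gaussBlock n).real
      {z | g (h • x1 m0 m1 + k • x2 m0 m2 + z) ≠ (m0, m1)}) ≤ ε) :
    Real.log (Fintype.card M1) ≤ Real.log 2 + ε * Real.log (Fintype.card M1) + privateInfo c x1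
      + n * Real.log (1 + ‖h‖ ^ 2 / (1 + ‖c‖ ^ 2)) := by
  have hF := genie_fano (A := M0 × M2) (C := Unit) (fun m m1 => c • x1 m.1 m1)
    (fun m m1 _ => h • x1 m.1 m1 + k • x2 m.1 m.2)
    (fun m => k • x2 m.1 m.2) (mmseCoeff h c)
    (v := 1 + ‖h‖ ^ 2 / (1 + ‖c‖ ^ 2)) (by positivity) (fun _ y => (g y).2)
    (fun _ m1 => by
      have : {y | (g y).2 = m1} = ⋃ m0, {y | g y = (m0, m1)} := by
        ext y; simp [Prod.ext_iff]
      rw [this]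
      exact MeasurableSet.iUnion fun m0 => hg _) ?_
  · simp only [awgnInfo_const, Fintype.expect_const, sub_zero] at hF
    rw [← Finset.univ_product_univ, Finset.expect_product, Finset.expect_product] at hF
    simp only [Fintype.expect_const] at hF
    have hle : (𝔼 m0, 𝔼 m2, 𝔼 m1, (gaussBlock n).real
        {z | (g (h • x1 m0 m1 + k • x2 m0 m2 + z)).2 ≠ m1}) ≤ ε := by
      refine le_trans ?_ hε
      refine Finset.expect_le_expect fun m0 _ => ?_
      rw [Finset.expect_comm]
      refine Finset.expect_le_expect fun m1 _ =>
        Finset.expect_le_expect fun m2 _ => measureReal_mono fun z hz hc => hz ?_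
      rw [hc]
    have hlog : 0 ≤ Real.log (Fintype.card M1) := Real.log_natCast_nonneg _
    have := mul_le_mul_of_nonneg_right hle hlog
    unfold privateInfo
    linarith
  · have hrew : ∀ (m : M0 × M2) m1, h • x1 m.1 m1 + k • x2 m.1 m.2 - k • x2 m.1 m.2
        - mmseCoeff h c • c • x1 m.1 m1 = (h - mmseCoeff h c * c) • x1 m.1 m1 := by
      intro m m1
      rw [sub_smul, mul_smul]; abel
    simp_rw [hrew, Fintype.expect_const, sqNorm_smul]
    rw [← Finset.univ_product_univ, Finset.expect_product]
    simp_rw [Fintype.expect_const, ← Finset.mul_expect, ← mmse_eq h c]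
    have h1 := mul_le_mul_of_nonneg_left hx1 (sq_nonneg ‖h - mmseCoeff h c * c‖)
    linarith

/-- The transmitters can correlate their codewords through the common message, so the received
power is bounded by that of coherent addition. -/
theorem log_card_prod_le (hg : ∀ m, MeasurableSet {y | g y = m})
    (hx1 : 𝔼 m0, 𝔼 m1, sqNorm (x1 m0 m1) ≤ n) (hx2 : 𝔼 m0, 𝔼 m2, sqNorm (x2 m0 m2) ≤ n)
    (hε : (𝔼 m0, 𝔼 m1, 𝔼 m2, (gaussBlock n).real
      {z | g (h • x1 m0 m1 + k • x2 m0 m2 + z) ≠ (m0, m1)}) ≤ ε) :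
    Real.log (Fintype.card M0) + Real.log (Fintype.card M1) ≤ Real.log 2
      + ε * (Real.log (Fintype.card M0) + Real.log (Fintype.card M1))
      - privateInfo k x2 + n * Real.log (1 + (‖h‖ + ‖k‖) ^ 2) := by
  have hlogs : Real.log (Fintype.card (M0 × M1))
      = Real.log (Fintype.card M0) + Real.log (Fintype.card M1) := by
    rw [Fintype.card_prod, Nat.cast_mul, Real.log_mul (by positivity) (by positivity)]
  have hF := genie_fano (A := Unit) (B := M0 × M1) (fun _ _ => 0)
    (fun _ m m2 => h • x1 m.1 m.2 + k • x2 m.1 m2) (fun _ => 0) 0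
    (v := 1 + (‖h‖ + ‖k‖) ^ 2) (by positivity) (fun _ y => g y) (fun _ m => hg m) ?_
  · simp only [awgnInfo_const, awgnInfo_add_const, Fintype.expect_const, hlogs] at hF
    rw [← Finset.univ_product_univ, Finset.expect_product, Finset.expect_product] at hF
    simp only [Fintype.expect_const] at hF
    have hlog : 0 ≤ Real.log (Fintype.card M0) + Real.log (Fintype.card M1) :=
      add_nonneg (Real.log_natCast_nonneg _) (Real.log_natCast_nonneg _)
    have := mul_le_mul_of_nonneg_right hε hlog
    unfold privateInfo
    linarith
  · simp only [Fintype.expect_const, sub_zero, smul_zero]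
    rw [← Finset.univ_product_univ, Finset.expect_product]
    have hle : 𝔼 m0, 𝔼 m1, 𝔼 m2, sqNorm (h • x1 m0 m1 + k • x2 m0 m2)
        ≤ 𝔼 m0, 𝔼 m1, 𝔼 m2, (‖h‖ + ‖k‖) *
          (‖h‖ * sqNorm (x1 m0 m1) + ‖k‖ * sqNorm (x2 m0 m2)) :=
      Finset.expect_le_expect fun m0 _ => Finset.expect_le_expect fun m1 _ =>
        Finset.expect_le_expect fun m2 _ => sqNorm_smul_add_smul_le _ _ _ _
    simp_rw [← Finset.mul_expect, Finset.expect_add_distrib, ← Finset.mul_expect,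
      Fintype.expect_const] at hle
    have h1 := mul_le_mul_of_nonneg_left hx1 (norm_nonneg h)
    have h2 := mul_le_mul_of_nonneg_left hx2 (norm_nonneg k)
    have h3 := mul_le_mul_of_nonneg_left (add_le_add h1 h2)
      (add_nonneg (norm_nonneg h) (norm_nonneg k))
    simp only [norm_zero]
    nlinarith

end

/-! ### From coding schemes to finite averages -/

theorem integral_uniformOn_univ {K : ℕ} (f : Fin K → ℝ) :
    ∫ i, f i ∂(uniformOn (Set.univ : Set (Fin K))) = 𝔼 i, f i := by
  rw [integral_fintype .of_finite, Fintype.expect_eq_sum_div_card, Finset.sum_div]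
  refine Finset.sum_congr rfl fun i _ => ?_
  rw [measureReal_def, uniformOn_univ]
  simp [div_eq_inv_mul]

instance {K : ℕ} : IsFiniteMeasure (uniformOn (Set.univ : Set (Fin K))) :=
  ⟨by
    rcases isEmpty_or_nonempty (Fin K) with h | h
    · simp [Set.univ_eq_empty_iff.2 h]
    · rw [uniformOn_univ]
      exact ENNReal.div_lt_top (by simp) (by exact_mod_cast Fintype.card_ne_zero)⟩

instance {K0 K1 K2 : ℕ} : IsFiniteMeasure (msgLaw K0 K1 K2) := by
  unfold msgLaw; infer_instance

theorem integral_msgLaw {K0 K1 K2 : ℕ} (f : Fin K0 × Fin K1 × Fin K2 → ℝ) :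
    ∫ m, f m ∂(msgLaw K0 K1 K2) = 𝔼 m0, 𝔼 m1, 𝔼 m2, f (m0, m1, m2) := by
  unfold msgLaw
  rw [integral_prod _ .of_finite]
  simp_rw [integral_prod (fun p : Fin K1 × Fin K2 => f (_, p)) .of_finite, integral_uniformOn_univ]

theorem expect_sqNorm_le_of_power {n : ℕ} (hn : 0 < n) {K0 K1 K2 : ℕ}
    {x : Fin K0 × Fin K1 × Fin K2 → Fin n → ℂ}
    (h : (1 / (n : ℝ)) * ∑ t, ∫ m, ‖x m t‖ ^ 2 ∂(msgLaw K0 K1 K2) ≤ 1) :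
    𝔼 m0, 𝔼 m1, 𝔼 m2, sqNorm (x (m0, m1, m2)) ≤ n := by
  have hn' : (0 : ℝ) < n := by exact_mod_cast hn
  rw [one_div, inv_mul_le_iff₀ hn', mul_one] at h
  simp_rw [integral_msgLaw] at h
  unfold sqNorm
  simp_rw [Finset.expect_sum_comm]
  exact h

theorem map_pi_eq_gaussBlock {n : ℕ} {noise : Measure (ℂ × ℂ)} [IsProbabilityMeasure noise]
    {π : ℂ × ℂ → ℂ} (hπ : Measurable π) (h : noise.map π = stdCN) :
    (Measure.pi fun _ : Fin n => noise).map (fun z t => π (z t)) = gaussBlock n := by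
  have : ∀ _ : Fin n, SigmaFinite (noise.map π) := fun _ => by rw [h]; infer_instance
  rw [Measure.pi_map_pi (fun _ => hπ.aemeasurable), h, gaussBlock]

theorem measureReal_prod_eq_expect {n K0 K1 K2 : ℕ} {D : Type*} [MeasurableSpace D]
    [MeasurableSingletonClass D] [Countable D]
    {noise : Measure (ℂ × ℂ)} [IsProbabilityMeasure noise] {π : ℂ × ℂ → ℂ} (hπ : Measurable π)
    (h : noise.map π = stdCN) (x : Fin K0 × Fin K1 × Fin K2 → Fin n → ℂ) {g : (Fin n → ℂ) → D}
    (hg : Measurable g) (τ : Fin K0 × Fin K1 × Fin K2 → D) :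
    ((msgLaw K0 K1 K2).prod (Measure.pi fun _ : Fin n => noise)).real
        {ω | g (x ω.1 + fun t => π (ω.2 t)) ≠ τ ω.1}
      = 𝔼 m0, 𝔼 m1, 𝔼 m2, (gaussBlock n).real
        {z | g (x (m0, m1, m2) + z) ≠ τ (m0, m1, m2)} := by
  have hx : Measurable fun ω : (Fin K0 × Fin K1 × Fin K2) × (Fin n → ℂ × ℂ) => x ω.1 :=
    (measurable_of_countable x).comp measurable_fst
  have hτ : Measurable fun ω : (Fin K0 × Fin K1 × Fin K2) × (Fin n → ℂ × ℂ) => τ ω.1 :=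
    (measurable_of_countable τ).comp measurable_fst
  have hE : MeasurableSet {ω : (Fin K0 × Fin K1 × Fin K2) × (Fin n → ℂ × ℂ) |
      g (x ω.1 + fun t => π (ω.2 t)) ≠ τ ω.1} :=
    (measurableSet_eq_fun (hg.comp (hx.add (by fun_prop))) hτ).compl
  rw [← integral_msgLaw (fun m => (gaussBlock n).real {z | g (x m + z) ≠ τ m}), measureReal_def,
    Measure.prod_apply hE, ← integral_toReal (measurable_of_countable _).aemeasurable
      (ae_of_all _ fun _ => measure_lt_top _ _)]
  congr 1 with m
  have hS : MeasurableSet {z : Fin n → ℂ | g (x m + z) ≠ τ m} :=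
    (hg.comp (measurable_const_add _) (measurableSet_singleton (τ m))).compl
  rw [← map_pi_eq_gaussBlock hπ h, map_measureReal_apply (by fun_prop) hS]
  rfl

/-- The rate bounds at one receiver, in bits per channel use, with slack `δ` for the error
probability `ε` and the rounding of the message counts. -/
theorem receiver_rate_bounds {n : ℕ} (hn : 0 < n) {M0 M1 M2 : Type*} [Fintype M0] [Fintype M1]
    [Fintype M2] [Nonempty M0] [Nonempty M1] [Nonempty M2] {h k c : ℂ} {x1 : M0 → M1 → Fin n → ℂ}
    {x2 : M0 → M2 → Fin n → ℂ} {g : (Fin n → ℂ) → M0 × M1} {ε δ R0 R1 : ℝ}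
    (hg : ∀ m, MeasurableSet {y | g y = m})
    (hx1 : 𝔼 m0, 𝔼 m1, sqNorm (x1 m0 m1) ≤ n) (hx2 : 𝔼 m0, 𝔼 m2, sqNorm (x2 m0 m2) ≤ n)
    (hε : (𝔼 m0, 𝔼 m1, 𝔼 m2, (gaussBlock n).real
      {z | g (h • x1 m0 m1 + k • x2 m0 m2 + z) ≠ (m0, m1)}) ≤ ε) (hε0 : 0 ≤ ε)
    (hR0 : 0 ≤ R0)
    (h0 : n * R0 * Real.log 2 - Real.log 2 ≤ Real.log (Fintype.card M0))
    (h0' : Real.log (Fintype.card M0) ≤ n * R0 * Real.log 2)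
    (h1 : n * R1 * Real.log 2 - Real.log 2 ≤ Real.log (Fintype.card M1))
    (h1' : Real.log (Fintype.card M1) ≤ n * R1 * Real.log 2)
    (hδ : 3 / n + ε * (R0 + R1) ≤ δ) :
    R1 ≤ capC (‖h‖ ^ 2) + δ ∧
    R1 ≤ privateInfo c x1 / (n * Real.log 2) + capC (‖h‖ ^ 2 / (1 + ‖c‖ ^ 2)) + δ ∧
    R1 ≤ capC (‖h‖ ^ 2 + ‖k‖ ^ 2) - privateInfo k x2 / (n * Real.log 2) + δ ∧
    R0 + R1 ≤ capC ((‖h‖ + ‖k‖) ^ 2) - privateInfo k x2 / (n * Real.log 2) + δ ∧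
    R1 ≤ privateInfo c x1 / (n * Real.log 2) - privateInfo k x2 / (n * Real.log 2)
      + capC (‖k‖ ^ 2 + ‖h‖ ^ 2 / (1 + ‖c‖ ^ 2)) + δ := by
  have hn' : (0 : ℝ) < n := by exact_mod_cast hn
  have hL : 0 < Real.log 2 := Real.log_pos one_lt_two
  have hnL : 0 < n * Real.log 2 := mul_pos hn' hL
  have hcap : ∀ P, capC P = n * Real.log (1 + P) / (n * Real.log 2) := fun P => by
    rw [mul_div_mul_left _ _ hn'.ne']; rfl
  have h3 : (3 : ℝ) / n = 3 * Real.log 2 / (n * Real.log 2) := by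
    rw [mul_div_mul_right _ _ hL.ne']
  have e1 := mul_le_mul_of_nonneg_left h1' hε0
  have e0 := mul_le_mul_of_nonneg_left h0' hε0
  have e0' : 0 ≤ ε * (n * R0 * Real.log 2) := by positivity
  -- The slack `3 log 2` covers the `log 2` of Fano's inequality and the rounding of two message
  -- counts.
  have div_bound : ∀ {R X : ℝ}, n * R * Real.log 2 ≤ 3 * Real.log 2
      + ε * (n * (R0 + R1) * Real.log 2) + X → R ≤ X / (n * Real.log 2) + δ := by
    intro R X hX
    refine le_trans ?_ (add_le_add_right hδ _)
    have : R = n * R * Real.log 2 / (n * Real.log 2) := by field_simp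
    have e : X / (n * Real.log 2) + (3 / n + ε * (R0 + R1))
        = (3 * Real.log 2 + ε * (n * (R0 + R1) * Real.log 2) + X) / (n * Real.log 2) := by
      field_simp; ring
    rw [e, this]
    exact div_le_div_of_nonneg_right hX hnL.le
  have d := log_card_le_of_genie_of_interference 0 hg hx1 hε
  have a := log_card_le_of_genie_of_interference c hg hx1 hε
  have g' := log_card_prod_le hg hx1 hx2 hε
  have e := log_card_le_of_genie c hg hx1 hx2 hε
  have g0 := log_card_le_of_genie 0 hg hx1 hx2 hε
  rw [privateInfo_zero] at d g0
  simp only [norm_zero, ne_eq, OfNat.ofNat_ne_zero, not_false_eq_true, zero_pow, add_zero,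
    div_one] at d g0
  simp only [hcap]
  rw [← add_div, ← sub_div, ← sub_div, ← sub_div, ← add_div, add_comm (‖h‖ ^ 2) (‖k‖ ^ 2)]
  refine ⟨div_bound ?_, div_bound ?_, div_bound ?_, div_bound ?_, div_bound ?_⟩ <;> linarith

/-- A decoder needs a nonempty message set, which a negative rate does not give. -/
theorem rate_nonneg_of_msgCount_pos {n : ℕ} (hn : 0 < n) {R : ℝ} (h : 0 < msgCount n R) :
    0 ≤ R := by
  by_contra hR
  have hn' : (0 : ℝ) < n := by exact_mod_cast hn
  have : (2 : ℝ) ^ ((n : ℝ) * R) < 1 :=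
    Real.rpow_lt_one_of_one_lt_of_neg one_lt_two (mul_neg_of_pos_of_neg hn' (not_le.1 hR))
  exact h.ne' (Nat.floor_eq_zero.2 this)

theorem log_msgCount_le {n : ℕ} {R : ℝ} (h : 0 < msgCount n R) :
    Real.log (msgCount n R) ≤ n * R * Real.log 2 := by
  rw [← Real.log_rpow two_pos]
  exact Real.log_le_log (by exact_mod_cast h) (Nat.floor_le (by positivity))

theorem le_log_msgCount {n : ℕ} {R : ℝ} (h : 0 < msgCount n R) :
    n * R * Real.log 2 - Real.log 2 ≤ Real.log (msgCount n R) := by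
  rw [← Real.log_rpow two_pos, ← Real.log_div (by positivity) two_ne_zero]
  refine Real.log_le_log (by positivity) ?_
  have h1 : (1 : ℝ) ≤ msgCount n R := by exact_mod_cast h
  have h2 := Nat.lt_floor_add_one ((2 : ℝ) ^ ((n : ℝ) * R))
  change (2 : ℝ) ^ ((n : ℝ) * R) < (msgCount n R : ℝ) + 1 at h2
  linarith

/-- The rate bounds at both receivers. The numbers `a` and `b` are the private information that
each transmitter leaks to the other's receiver. Each enters with opposite signs at the two
receivers. -/
theorem CodingScheme.rate_bounds {n : ℕ} (hn : 0 < n) {R0 R1 R2 : ℝ}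
    (S : CodingScheme n (msgCount n R0) (msgCount n R1) (msgCount n R2)) (H : Channel)
    {noise : Measure (ℂ × ℂ)} (hZ1 : noise.map Prod.fst = stdCN)
    (hZ2 : noise.map Prod.snd = stdCN) {δ : ℝ}
    (hδ : 3 / n + S.errorProb H noise * (R0 + R1 + R2) ≤ δ) :
    (0 ≤ R0 ∧ 0 ≤ R1 ∧ 0 ≤ R2) ∧ ∃ a b : ℝ, 0 ≤ a ∧ 0 ≤ b ∧
      (R1 ≤ H.D1 + δ ∧ R1 ≤ a + H.A1 + δ ∧ R1 ≤ H.G1 - b + δ ∧ R0 + R1 ≤ H.G1' - b + δ ∧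
        R1 ≤ a - b + H.E1 + δ) ∧
      (R2 ≤ H.D2 + δ ∧ R2 ≤ b + H.A2 + δ ∧ R2 ≤ H.G2 - a + δ ∧ R0 + R2 ≤ H.G2' - a + δ ∧
        R2 ≤ b - a + H.E2 + δ) := by
  have : IsProbabilityMeasure noise := by
    have h : IsProbabilityMeasure (noise.map Prod.fst) := by rw [hZ1]; infer_instance
    exact (Measure.isProbabilityMeasure_map_iff measurable_fst.aemeasurable).1 h
  have : Nonempty (Fin (msgCount n R0)) := ⟨(S.dec1 0).1⟩
  have : Nonempty (Fin (msgCount n R1)) := ⟨(S.dec1 0).2⟩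
  have : Nonempty (Fin (msgCount n R2)) := ⟨(S.dec2 0).2⟩
  have k0 : 0 < msgCount n R0 := Fin.pos_iff_nonempty.2 ‹_›
  have k1 : 0 < msgCount n R1 := Fin.pos_iff_nonempty.2 ‹_›
  have k2 : 0 < msgCount n R2 := Fin.pos_iff_nonempty.2 ‹_›
  have r0 := rate_nonneg_of_msgCount_pos hn k0
  have r1 := rate_nonneg_of_msgCount_pos hn k1
  have r2 := rate_nonneg_of_msgCount_pos hn k2
  have hn' : (0 : ℝ) < n := by exact_mod_cast hn
  have hL : 0 < Real.log 2 := Real.log_pos one_lt_two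
  have hε0 : 0 ≤ S.errorProb H noise := measureReal_nonneg
  have p1 : 𝔼 m0, 𝔼 m1, sqNorm (S.enc1 m0 m1) ≤ n := by
    simpa [Fintype.expect_const] using expect_sqNorm_le_of_power hn S.power1
  have p2 : 𝔼 m0, 𝔼 m2, sqNorm (S.enc2 m0 m2) ≤ n := by
    simpa [Fintype.expect_const] using expect_sqNorm_le_of_power hn S.power2
  have err1 : (𝔼 m0, 𝔼 m1, 𝔼 m2, (gaussBlock n).real
      {z | S.dec1 (H.h11 • S.enc1 m0 m1 + H.h12 • S.enc2 m0 m2 + z) ≠ (m0, m1)})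
      ≤ S.errorProb H noise := by
    rw [← measureReal_prod_eq_expect measurable_fst hZ1
      (fun m => H.h11 • S.enc1 m.1 m.2.1 + H.h12 • S.enc2 m.1 m.2.2) S.measurable_dec1
      (fun m => (m.1, m.2.1))]
    refine measureReal_mono fun ω hω => ?_
    by_contra hc
    simp only [CodingScheme.errorEvent, Set.mem_ofPred_eq, not_or, not_not] at hc
    exact hω (Prod.ext hc.2.2.1.symm hc.1.symm)
  have err2 : (𝔼 m0, 𝔼 m2, 𝔼 m1, (gaussBlock n).real
      {z | S.dec2 (H.h22 • S.enc2 m0 m2 + H.h21 • S.enc1 m0 m1 + z) ≠ (m0, m2)})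
      ≤ S.errorProb H noise := by
    simp_rw [fun m0 => Finset.expect_comm (Finset.univ : Finset (Fin (msgCount n R2)))
      (Finset.univ : Finset (Fin (msgCount n R1))) fun m2 m1 => (gaussBlock n).real
        {z | S.dec2 (H.h22 • S.enc2 m0 m2 + H.h21 • S.enc1 m0 m1 + z) ≠ (m0, m2)}]
    rw [← measureReal_prod_eq_expect measurable_snd hZ2
      (fun m => H.h22 • S.enc2 m.1 m.2.2 + H.h21 • S.enc1 m.1 m.2.1) S.measurable_dec2
      (fun m => (m.1, m.2.2))]
    refine measureReal_mono fun ω hω => ?_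
    by_contra hc
    simp only [CodingScheme.errorEvent, Set.mem_ofPred_eq, not_or, not_not] at hc
    refine hω ?_
    rw [add_comm (H.h22 • _)]
    exact Prod.ext hc.2.2.2.symm hc.2.1.symm
  have b1 := receiver_rate_bounds (c := H.h21) (δ := δ) hn
    (fun m => S.measurable_dec1 (measurableSet_singleton m)) p1 p2 err1 hε0 r0
    (by simpa using le_log_msgCount k0) (by simpa using log_msgCount_le k0)
    (by simpa using le_log_msgCount k1) (by simpa using log_msgCount_le k1)
    (by linarith [mul_nonneg hε0 r2])
  have b2 := receiver_rate_bounds (c := H.h12) (δ := δ) hn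
    (fun m => S.measurable_dec2 (measurableSet_singleton m)) p2 p1 err2 hε0 r0
    (by simpa using le_log_msgCount k0) (by simpa using log_msgCount_le k0)
    (by simpa using le_log_msgCount k2) (by simpa using log_msgCount_le k2)
    (by linarith [mul_nonneg hε0 r1])
  exact ⟨⟨r0, r1, r2⟩, privateInfo H.h21 S.enc1 / (n * Real.log 2),
    privateInfo H.h12 S.enc2 / (n * Real.log 2), div_nonneg (privateInfo_nonneg _ _) (by positivity),
    div_nonneg (privateInfo_nonneg _ _) (by positivity), b1, b2⟩

/-! ### Achievable rates and the capacity region -/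

theorem Achievable.mem_outerRegion {H : Channel} {noise : Measure (ℂ × ℂ)}
    (hZ1 : noise.map Prod.fst = stdCN) (hZ2 : noise.map Prod.snd = stdCN) {R : ℝ × ℝ × ℝ}
    (h : Achievable H noise R) : R ∈ outerRegion H := by
  obtain ⟨R0, R1, R2⟩ := R
  obtain ⟨S, hS⟩ := h
  have hlim : Tendsto (fun n : ℕ => 3 / (n : ℝ) + (S n).errorProb H noise * (R0 + R1 + R2))
      atTop (𝓝 0) := by
    simpa using (tendsto_const_div_atTop_nhds_zero_nat 3).add (hS.mul_const (R0 + R1 + R2))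
  have key : ∀ δ : ℝ, 0 < δ →
      ∃ n : ℕ, 0 < n ∧ 3 / (n : ℝ) + (S n).errorProb H noise * (R0 + R1 + R2) ≤ δ := fun δ hδ =>
    ((eventually_gt_atTop 0).and (hlim.eventually_le_const hδ)).exists
  obtain ⟨n, hn, hn1⟩ := key 1 one_pos
  obtain ⟨r0, r1, r2⟩ := ((S n).rate_bounds hn H hZ1 hZ2 hn1).1
  refine ⟨R0, R1, R2, rfl, r0, r1, r2, ?_, ?_, ?_, ?_, ?_, ?_, ?_, ?_, ?_, ?_, ?_, ?_, ?_⟩ <;>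
  · refine le_of_forall_pos_le_add fun η hη => ?_
    obtain ⟨n, hn, hnη⟩ := key (η / 3) (by positivity)
    obtain ⟨-, a, b, ha, hb, ⟨d1, a1, g1, g1', e1⟩, d2, a2, g2, g2', e2⟩ :=
      (S n).rate_bounds hn H hZ1 hZ2 hnη
    -- Each inequality of the region adds up at most three of these, with `a` and `b` cancelling or
    -- dropped by their sign.
    linarith

theorem isClosed_outerRegion (H : Channel) : IsClosed (outerRegion H) := by
  have : outerRegion H = {R : ℝ × ℝ × ℝ |
      0 ≤ R.1 ∧ 0 ≤ R.2.1 ∧ 0 ≤ R.2.2 ∧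
      R.1 + R.2.1 ≤ H.G1' ∧
      R.1 + R.2.2 ≤ H.G2' ∧
      R.2.1 ≤ H.D1 ∧
      R.2.2 ≤ H.D2 ∧
      R.2.1 + R.2.2 ≤ H.E1 + H.E2 ∧
      R.2.1 + R.2.2 ≤ H.A1 + H.G2 ∧
      R.2.1 + R.2.2 ≤ H.A2 + H.G1 ∧
      R.1 + R.2.1 + R.2.2 ≤ H.A1 + H.G2' ∧
      R.1 + R.2.1 + R.2.2 ≤ H.A2 + H.G1' ∧
      2 * R.2.1 + R.2.2 ≤ H.A1 + H.G1 + H.E2 ∧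
      R.2.1 + 2 * R.2.2 ≤ H.A2 + H.G2 + H.E1 ∧
      R.1 + 2 * R.2.1 + R.2.2 ≤ H.A1 + H.G1' + H.E2 ∧
      R.1 + R.2.1 + 2 * R.2.2 ≤ H.A2 + H.G2' + H.E1} := by
    ext R
    constructor
    · rintro ⟨R0, R1, R2, rfl, h⟩
      exact h
    · exact fun h => ⟨R.1, R.2.1, R.2.2, rfl, h⟩
  rw [this]
  simp only [Set.ofPred_and]
  repeat' apply IsClosed.inter
  all_goals exact isClosed_le (by fun_prop) (by fun_prop)

end ICCI

theorem theorem3 (H : ICCI.Channel) (noise : MeasureTheory.Measure (ℂ × ℂ))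
    (hZ1 : noise.map Prod.fst = ICCI.stdCN) (hZ2 : noise.map Prod.snd = ICCI.stdCN) :
    ICCI.capacityRegion H noise ⊆ ICCI.outerRegion H :=
  closure_minimal (fun _ hR => hR.mem_outerRegion hZ1 hZ2) (ICCI.isClosed_outerRegion H)
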